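/- Let $d\ge 1$, let $U=\mathbb R^d$ or $U=\mathbb R^d_+=\{x\in\mathbb R^d:x^1>0\}$, and put $\Omega=(0,\infty)\times U$ with Lebesgue measure. Functions are real- or complex-valued. **Scaling function.** Let $\varphi:(0,\infty)\to(0,\infty)$ be nondecreasing with $\lim_{r\downarrow0}\varphi(r)=0$, $\lim_{r\uparrow\infty}\varphi(r)=\infty$, $\sup_{r>0}\varphi(2r)/\varphi(r)<\infty$, and suppose that for some $\lambda_0>1$ we have $\varphi(\lambda_0r)\ge2\varphi(r)$ for all $r>0$. For $c>0$, $t_0\ge0$, $x_0\in U$ let $$Q_c^\varphi(t_0,x_0)=(t_0,t_0+\varphi(c)]\times B_c(x_0),\qquad B_c(x_0)=\{y\in U:|x_0-y|<c\},$$ and for locally integrable $g$ on $\Omega$ define $$g_\varphi^\sharp(t,x)=\sup_{Q\ni(t,x)}\frac1{|Q|}\int_Q|g-g_Q|\,ds\,dy,\qquad g_Q=\frac1{|Q|}\int_Q g\,ds\,dy,$$ the supremum being over all $Q=Q_c^\varphi(t_0,x_0)$ (with $c>0$, $t_0\ge 0$, $x_0\in U$) that contain $(t,x)$. **Operator.**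 Let $K(s,t,y,x)$ be a measurable function on $(0,\infty)\times(0,\infty)\times U\times U$ with $K(s,t,y,x)=0$ whenever $s\ge t$. For $\varepsilon>0$ let $$\mathcal T_\varepsilon f(t,x)=\int_0^{t-\varepsilon}\!\int_U K(s,t,y,x)f(s,y)\,dy\,ds$$ (which is $0$ if $t\le\varepsilon$). Assume that for every $f\in L_2(\Omega)$ and $\varepsilon>0$ this integral converges absolutely for a.e. $(t,x)\in\Omega$, that $\mathcal T_\varepsilon f$ converges in $L_2(\Omega)$ as $\varepsilon\downarrow0$ to a limit, denoted $\mathcal Tf$, and that there is a constant $N_5$ with $\|\mathcal Tf\|_{L_2(\Omega)}\le N_5\|f\|_{L_2(\Omega)}$ for all $f\in L_2(\Omega)$. **$\varphi$-type Hörmander condition.** Assume that there are a function $\tilde\varphi:(0,\infty)\to(0,\infty)$ and constants $c_1,c_2>0$ with $$r\le c_1\varphi(\tilde\varphi(r))\quad\text{for all } r>0,\qquad \tilde\varphi(\rho)\le c_2r\quad\text{for all } r>0,\ 0<\rho\le\varphi(r),$$ and constants $c_0,N_6>0$ such that for all $(t,x),(s,y)\in\Omega$ with $t\ne s$ $$\int_{\{(r,z)\in\Omega\,:\,\tilde\varphi(|t-r|)+|x-z|\ge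 c_0(\tilde\varphi(|t-s|)+|x-y|)\}}|K(r,t,z,x)-K(r,s,z,y)|\,dr\,dz\le N_6 .$$ **Conclusion.** Let $2<p<\infty$. Then there is a constant $N$ such that for every $f\in L_2(\Omega)\cap L_\infty(\Omega)$: (i) $\|(\mathcal Tf)_\varphi^\sharp\|_{L_\infty(\Omega)}\le N\|f\|_{L_\infty(\Omega)}$; (ii) $\|\mathcal Tf\|_{L_p(\Omega)}\le N\|f\|_{L_p(\Omega)}$. -/

import Mathlib

open Set Filter Topology MeasureTheory
open scoped ENNReal NNReal

noncomputable section

namespace VolterraBMO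

/-- `ℝ^d` with its Euclidean norm and Lebesgue measure. -/
abbrev Eucl (d : ℕ) : Type := EuclideanSpace ℝ (Fin d)

/-- The open half-space `ℝ^d_+ = {x : x¹ > 0}`, for `d ≥ 1`. -/
def halfSpace (d : ℕ) (hd : 0 < d) : Set (Eucl d) := {x | 0 < x ⟨0, hd⟩}

/-- Lebesgue measure on `(0,∞) × U`, as a measure on `ℝ × ℝ^d`. -/
def cylMeasure {d : ℕ} (U : Set (Eucl d)) : Measure (ℝ × Eucl d) :=
  (volume : Measure (ℝ × Eucl d)).restrict (Ioi (0 : ℝ) ×ˢ U)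

/-- The parabolic cylinder `Q^φ_c(t,x) = (t, t + φ(c)] × {y ∈ U : |x - y| < c}`. -/
def cylinder {d : ℕ} (U : Set (Eucl d)) (φ : ℝ → ℝ) (c t : ℝ) (x : Eucl d) :
    Set (ℝ × Eucl d) :=
  Ioc t (t + φ c) ×ˢ (Metric.ball x c ∩ U)

/-- The `φ`-type sharp function: the supremum, over all cylinders `Q = Q^φ_c(t₀,x₀)` with
`t₀ ≥ 0`, `x₀ ∈ U`, `c > 0` that contain `z`, of the mean over `Q` of `|g - g_Q|`,
where `g_Q` is the mean of `g` over `Q`. -/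
def sharpFn {𝕜 : Type*} [RCLike 𝕜] {d : ℕ} (U : Set (Eucl d)) (φ : ℝ → ℝ)
    (g : ℝ × Eucl d → 𝕜) (z : ℝ × Eucl d) : ℝ≥0∞ :=
  ⨆ (c : ℝ) (t₀ : ℝ) (x₀ : Eucl d)
    (_ : 0 < c ∧ 0 ≤ t₀ ∧ x₀ ∈ U ∧ z ∈ cylinder U φ c t₀ x₀),
    ⨍⁻ w in cylinder U φ c t₀ x₀, ‖g w - ⨍ v in cylinder U φ c t₀ x₀, g v ∂volume‖ₑ ∂volume

/-- The conditions on the scaling function `φ : (0,∞) → (0,∞)`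
(values of `φ` outside `(0,∞)` are irrelevant). -/
structure IsScaling (φ : ℝ → ℝ) : Prop where
  pos : ∀ r, 0 < r → 0 < φ r
  mono : MonotoneOn φ (Ioi 0)
  tendsto_zero : Tendsto φ (𝓝[>] 0) (𝓝 0)
  tendsto_top : Tendsto φ atTop atTop
  /-- `sup_{r > 0} φ(2r) / φ(r) < ∞` -/
  doubling : ∃ C : ℝ, ∀ r, 0 < r → φ (2 * r) / φ r ≤ C
  growth : ∃ l : ℝ, 1 < l ∧ ∀ r, 0 < r → 2 * φ r ≤ φ (l * r)

/-- The kernel `K(s,t,y,x)` is Lebesgue measurable on `(0,∞) × (0,∞) × U × U` and vanishes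
there for `s ≥ t`. -/
structure IsVolterraKernel {𝕜 : Type*} [RCLike 𝕜] {d : ℕ} (U : Set (Eucl d))
    (K : ℝ → ℝ → Eucl d → Eucl d → 𝕜) : Prop where
  measurable : AEStronglyMeasurable
    (fun q : (ℝ × Eucl d) × (ℝ × Eucl d) => K q.1.1 q.2.1 q.1.2 q.2.2)
    ((cylMeasure U).prod (cylMeasure U))
  eq_zero : ∀ s t : ℝ, 0 < s → 0 < t → t ≤ s → ∀ y ∈ U, ∀ x ∈ U, K s t y x = 0

/-- The truncated operator `T_ε f(t,x) = ∫_0^{t-ε} ∫_U K(s,t,y,x) f(s,y) dy ds`. -/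
def truncOp {𝕜 : Type*} [RCLike 𝕜] {d : ℕ} (U : Set (Eucl d))
    (K : ℝ → ℝ → Eucl d → Eucl d → 𝕜) (ε : ℝ) (f : ℝ × Eucl d → 𝕜)
    (z : ℝ × Eucl d) : 𝕜 :=
  ∫ w in Ioo 0 (z.1 - ε) ×ˢ U, K w.1 z.1 w.2 z.2 * f w

/-- `g ∈ L_2((0,∞) × U)` is the limit of `T_ε f` in `L_2((0,∞) × U)` as `ε ↓ 0`. -/
def IsTruncLimit {𝕜 : Type*} [RCLike 𝕜] {d : ℕ} (U : Set (Eucl d))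
    (K : ℝ → ℝ → Eucl d → Eucl d → 𝕜) (f g : ℝ × Eucl d → 𝕜) : Prop :=
  MemLp g 2 (cylMeasure U) ∧
    Tendsto (fun ε : ℝ => eLpNorm (truncOp U K ε f - g) 2 (cylMeasure U)) (𝓝[>] 0) (𝓝 0)

open Classical in
/-- The operator `T f = lim_{ε ↓ 0} T_ε f`, limit in `L_2((0,∞) × U)`. The limit, where it
exists, is unique up to null sets; a representative of it is chosen. -/
def volterraOp {𝕜 : Type*} [RCLike 𝕜] {d : ℕ} (U : Set (Eucl d))
    (K : ℝ → ℝ → Eucl d → Eucl d → 𝕜) (f : ℝ × Eucl d → 𝕜) : ℝ × Eucl d → 𝕜 :=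
  if h : ∃ g, IsTruncLimit U K f g then h.choose else 0

/-- `T` is a well-defined bounded operator on `L_2((0,∞) × U)`: for each `f` in `L_2`,
the integrals `T_ε f(t,x)` converge absolutely for almost every `(t,x)`, `T_ε f → T f` in `L_2`,
and `‖T f‖_{L_2} ≤ N₅ ‖f‖_{L_2}` with `N₅` independent of `f`. -/
structure IsL2Bounded {𝕜 : Type*} [RCLike 𝕜] {d : ℕ} (U : Set (Eucl d))
    (K : ℝ → ℝ → Eucl d → Eucl d → 𝕜) : Prop where
  integrable : ∀ f : ℝ × Eucl d → 𝕜, MemLp f 2 (cylMeasure U) → ∀ ε : ℝ, 0 < ε →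
    ∀ᵐ z ∂(cylMeasure U),
      IntegrableOn (fun w : ℝ × Eucl d => K w.1 z.1 w.2 z.2 * f w) (Ioo 0 (z.1 - ε) ×ˢ U)
  tendsto : ∀ f : ℝ × Eucl d → 𝕜, MemLp f 2 (cylMeasure U) →
    IsTruncLimit U K f (volterraOp U K f)
  bound : ∃ N₅ : ℝ≥0, ∀ f : ℝ × Eucl d → 𝕜, MemLp f 2 (cylMeasure U) →
    eLpNorm (volterraOp U K f) 2 (cylMeasure U) ≤ N₅ * eLpNorm f 2 (cylMeasure U)

/-- The `φ`-type Hörmander condition, with an auxiliary function `φ' : (0,∞) → (0,∞)` that is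
inverse to `φ` up to constants. The upper bound on `φ'` is asked for on the whole interval
`(0, φ(r)]`, which follows from the bound at `φ(r)` alone if `φ'` is nondecreasing or if `φ` is
continuous. Since `φ'(0)` has no meaning, the integral bound is only asked for `t ≠ s`. -/
def HormanderCondition {𝕜 : Type*} [RCLike 𝕜] {d : ℕ} (U : Set (Eucl d)) (φ : ℝ → ℝ)
    (K : ℝ → ℝ → Eucl d → Eucl d → 𝕜) : Prop :=
  ∃ φ' : ℝ → ℝ,
    (∀ r, 0 < r → 0 < φ' r) ∧
    (∃ c₁ : ℝ, 0 < c₁ ∧ ∀ r, 0 < r → r ≤ c₁ * φ (φ' r)) ∧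
    (∃ c₂ : ℝ, 0 < c₂ ∧ ∀ r, 0 < r → ∀ ρ, 0 < ρ → ρ ≤ φ r → φ' ρ ≤ c₂ * r) ∧
    ∃ c₀ : ℝ, 0 < c₀ ∧ ∃ N₆ : ℝ≥0,
      ∀ t s : ℝ, 0 < t → 0 < s → t ≠ s → ∀ x ∈ U, ∀ y ∈ U,
        ∫⁻ q in {q : ℝ × Eucl d | q ∈ Ioi (0 : ℝ) ×ˢ U ∧
            c₀ * (φ' |t - s| + ‖x - y‖) ≤ φ' |t - q.1| + ‖x - q.2‖},
          ‖K q.1 t q.2 x - K q.1 s q.2 y‖ₑ ≤ N₆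

end VolterraBMO

end

/-!
The operator `T` is bounded from `L_∞` to `BMO` by the usual decomposition. Given a cylinder `Q`,
split `f` into its parts on and off a fixed enlargement `Q'` of `Q`. The first part is handled by
the `L_2` bound and Cauchy–Schwarz, since `|Q'| ≤ A² |Q|` by the doubling property of `φ`. For the
second part, `T f z - T f w` with `z, w ∈ Q` is at most the `L_1` norm off `Q'` of the difference of
the kernels at `z` and `w` times the supremum of `|f|`, and the Hörmander condition bounds this
(`ae_enorm_volterraOp_sub_le`). Since the integrals defining `T` converge only as limits of
truncations, the identity behind this bound is proved for the truncations first; the Volterra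
property `K(s,t,·,·) = 0` for `s ≥ t` makes the mismatch between truncations at different times
vanish in the limit (`enorm_sub_le_of_tendsto_truncOp`). The result is
`exists_oscillation_bound`.

The `L_p` bound does not go through separate Fefferman–Stein and Marcinkiewicz theorems; the two
are merged into one good-`λ` argument on a nested sequence of partitions of `(0,∞) × U` into
parabolic dyadic cells (`gridCode`). For each height `h`, the part `f 1_{|f| ≤ h}` contributes at
most `C h` to the mean oscillation of `g = T f` over a cell, and the rest `f' = f 1_{|f| > h}` at
most twice the mean of `|T f'|`. With `h = γλ` this gives, for the dyadic maximal function `M`,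
`|{M g > 2λ}| ≤ C' γ |{M g > λ}| + |{M (T f') > γλ}|` (`IsGrid.good_lambda`). The last term is at
most `C (γλ)⁻² ∫_{|f| > γλ} |f|²` by the weak type `(2,2)` bound. Multiplying by `λ^(p-1)` and
integrating, the first term is absorbed for small `γ`, and the second yields a multiple of
`∫ |f|^p` because `p > 2` (`IsGrid.lintegral_rpow_le`). Finally `|g| ≤ M g` almost everywhere
(`IsGrid.measure_lt_enorm_le`).
-/

namespace VolterraBMO

/-! ### Nested partitions and the dyadic maximal function -/

section Grid

variable {X ι : Type*}

/-- The cell of generation `n` containing `x`, for the sequence of partitions of `X` into the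
fibres of the maps `code n`. Generations get finer as `n` increases. -/
def cell (code : ℤ → X → ι) (n : ℤ) (x : X) : Set X := {y | code n y = code n x}

/-- A nested sequence of measurable partitions into cells of finite measure which is
doubling (a parent is at most `D` times as large as a child) and whose cells exhaust infinite
measure as the generation tends to `-∞`. Null cells are allowed; their ancestors are then null
as well. Countability of the partitions is asked for separately, as countability of `ι`. -/
structure IsGrid [MeasurableSpace X] (μ : Measure X) (code : ℤ → X → ι) (D : ℝ≥0) : Prop where
  measurableSet_fiber : ∀ n i, MeasurableSet (code n ⁻¹' {i})
  nested : ∀ n x y, code n x = code n y → code (n - 1) x = code (n - 1) y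
  finite : ∀ n x, μ (cell code n x) ≠ ∞
  doubling : ∀ n x, μ (cell code (n - 1) x) ≤ D * μ (cell code n x)
  large : ∀ x, (∀ n, μ (cell code n x) = 0) ∨
    Tendsto (fun n => μ (cell code n x)) atBot (𝓝 ∞)

/-- The set where the dyadic maximal function of `u` exceeds `a`, that is, the union of the cells
over which the mean of `u` exceeds `a`. It is stated with integrals instead of means, which
avoids division; null cells do not contribute. -/
def levelSet [MeasurableSpace X] (μ : Measure X) (code : ℤ → X → ι) (u : X → ℝ≥0∞) (a : ℝ≥0∞) :
    Set X :=
  {x | ∃ n, a * μ (cell code n x) < ∫⁻ y in cell code n x, u y ∂μ}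

lemma mem_cell_self (code : ℤ → X → ι) (n : ℤ) (x : X) : x ∈ cell code n x := rfl

lemma cell_eq_of_mem {code : ℤ → X → ι} {n : ℤ} {x y : X} (h : y ∈ cell code n x) :
    cell code n y = cell code n x := by
  have h' : code n y = code n x := h
  ext z
  simp [cell, h']

variable [MeasurableSpace X] {μ : Measure X} {code : ℤ → X → ι} {D : ℝ≥0}

lemma IsGrid.measurableSet_cell (hG : IsGrid μ code D) (n : ℤ) (x : X) :
    MeasurableSet (cell code n x) := hG.measurableSet_fiber n (code n x)

lemma IsGrid.code_eq_of_le (hG : IsGrid μ code D) {m n : ℤ} (hmn : m ≤ n) {x y : X}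
    (h : code n x = code n y) : code m x = code m y := by
  obtain ⟨k, rfl⟩ := Int.le.dest hmn
  induction k with
  | zero => simpa using h
  | succ k ih =>
    refine ih (by omega) ?_
    have := hG.nested _ _ _ h
    have e : m + ((k + 1 : ℕ) : ℤ) - 1 = m + k := by push_cast; ring
    rwa [e] at this

lemma IsGrid.cell_subset (hG : IsGrid μ code D) {m n : ℤ} (hmn : m ≤ n) (x : X) :
    cell code n x ⊆ cell code m x := fun _ hy => hG.code_eq_of_le hmn hy

/-- If `E` is the disjoint union of the stopping cells `cell (N x) x`, `x ∈ E`, an inequality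
between two measures on each stopping cell gives the inequality on `E`. -/
lemma IsGrid.measure_le_of_stopping [Countable ι] (hG : IsGrid μ code D) {E : Set X} {N : X → ℤ}
    (hN : ∀ x ∈ E, ∀ y ∈ cell code (N x) x, y ∈ E ∧ N y = N x) {ν ρ : Measure X}
    (h : ∀ x ∈ E, ν (cell code (N x) x) ≤ ρ (cell code (N x) x)) : ν E ≤ ρ E := by
  set key : X → ℤ × ι := fun x => (N x, code (N x) x) with hkey
  have hE : E = ⋃ p ∈ key '' E, code p.1 ⁻¹' {p.2} := by
    ext y
    simp only [mem_iUnion, mem_preimage, mem_singleton_iff, exists_prop]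
    constructor
    · exact fun hy => ⟨key y, mem_image_of_mem key hy, rfl⟩
    · rintro ⟨_, ⟨x, hx, rfl⟩, hy⟩
      exact (hN x hx y hy).1
  have hd : (key '' E).PairwiseDisjoint (fun p => code p.1 ⁻¹' {p.2}) := by
    rintro _ ⟨x, hx, rfl⟩ _ ⟨y, hy, rfl⟩ hne
    refine Set.disjoint_left.2 fun z hz hz' => hne ?_
    have h1 : N x = N y := (hN x hx z hz).2.symm.trans (hN y hy z hz').2
    have h2 : code (N x) z = code (N x) x := hz
    have h3 : code (N y) z = code (N y) y := hz'
    change (N x, code (N x) x) = (N y, code (N y) y)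
    rw [← h2, ← h3, h1]
  have hm : ∀ p ∈ key '' E, MeasurableSet (code p.1 ⁻¹' {p.2}) :=
    fun p _ => hG.measurableSet_fiber _ _
  rw [hE, measure_biUnion (to_countable _) hd hm, measure_biUnion (to_countable _) hd hm]
  refine ENNReal.tsum_le_tsum ?_
  rintro ⟨_, ⟨x, hx, rfl⟩⟩
  exact h x hx

/-- Null cells are negligible, because there are only countably many cells. -/
lemma IsGrid.ae_cell_ne_zero [Countable ι] (hG : IsGrid μ code D) :
    ∀ᵐ x ∂μ, ∀ n, μ (cell code n x) ≠ 0 := by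
  rw [ae_all_iff]
  intro n
  have := hG.measure_le_of_stopping (E := {x | μ (cell code n x) = 0}) (N := fun _ => n)
    (fun x hx y hy => ⟨(congrArg μ (cell_eq_of_mem hy)).trans hx, rfl⟩)
    (ν := μ) (ρ := 0) (fun x hx => (show μ (cell code n x) = 0 from hx).le)
  rw [ae_iff]
  simpa using this

/-- The cells over which the mean of an integrable function exceeds a positive number have
bounded size. -/
lemma IsGrid.bddBelow_of_lintegral_ne_top (hG : IsGrid μ code D) {u : X → ℝ≥0∞} {a : ℝ≥0∞}
    (ha : a ≠ 0) (hu : ∫⁻ x, u x ∂μ ≠ ∞) (x : X) :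
    ∃ m₀ : ℤ, ∀ m, a * μ (cell code m x) < ∫⁻ y in cell code m x, u y ∂μ → m₀ ≤ m := by
  rcases hG.large x with h0 | h
  · refine ⟨0, fun m hm => ?_⟩
    rw [Measure.restrict_eq_zero.2 (h0 m)] at hm
    simp at hm
  · have h1 : Tendsto (fun n => a * μ (cell code n x)) atBot (𝓝 (a * ∞)) :=
      ENNReal.Tendsto.const_mul h (Or.inl (by simp))
    rw [ENNReal.mul_top ha] at h1
    obtain ⟨m₀, hm₀⟩ := eventually_atBot.1 (h1.eventually (lt_mem_nhds (lt_top_iff_ne_top.2 hu)))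
    refine ⟨m₀, fun m hm => ?_⟩
    by_contra hlt
    exact (hm.trans_le (setLIntegral_le_lintegral _ _)).not_gt (hm₀ m (by omega))

/-- The largest cells over which the mean of `u` exceeds `a`. -/
lemma exists_stopping {u : X → ℝ≥0∞} {a : ℝ≥0∞}
    (hb : ∀ x, ∃ m₀ : ℤ, ∀ m,
      a * μ (cell code m x) < ∫⁻ y in cell code m x, u y ∂μ → m₀ ≤ m) :
    ∃ N : X → ℤ, ∀ x ∈ levelSet μ code u a,
      a * μ (cell code (N x) x) < ∫⁻ y in cell code (N x) x, u y ∂μ ∧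
      ∀ m, a * μ (cell code m x) < ∫⁻ y in cell code m x, u y ∂μ → N x ≤ m := by
  choose! N hN using fun x (hx : x ∈ levelSet μ code u a) => Int.exists_least_of_bdd (hb x) hx
  exact ⟨N, hN⟩

/-- Stopping times are constant on stopping cells, so that these are pairwise disjoint or equal. -/
lemma IsGrid.stopping_const (hG : IsGrid μ code D) {u : X → ℝ≥0∞} {a : ℝ≥0∞} {N : X → ℤ}
    (hN : ∀ x ∈ levelSet μ code u a,
      a * μ (cell code (N x) x) < ∫⁻ y in cell code (N x) x, u y ∂μ ∧
      ∀ m, a * μ (cell code m x) < ∫⁻ y in cell code m x, u y ∂μ → N x ≤ m) :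
    ∀ x ∈ levelSet μ code u a, ∀ y ∈ cell code (N x) x, y ∈ levelSet μ code u a ∧ N y = N x := by
  intro x hx y hy
  have hxy := cell_eq_of_mem hy
  have hyE : y ∈ levelSet μ code u a := ⟨N x, by rw [hxy]; exact (hN x hx).1⟩
  have h1 : N y ≤ N x := (hN y hyE).2 _ (by rw [hxy]; exact (hN x hx).1)
  have h2 : cell code (N y) y = cell code (N y) x :=
    cell_eq_of_mem (hG.code_eq_of_le h1 hy)
  exact ⟨hyE, le_antisymm h1 ((hN x hx).2 _ (by rw [← h2]; exact (hN y hyE).1))⟩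

/-- The weak type `(1,1)` bound for the dyadic maximal function. -/
lemma IsGrid.mul_measure_levelSet_le [Countable ι] (hG : IsGrid μ code D) {u : X → ℝ≥0∞}
    {a : ℝ≥0∞} (ha : a ≠ 0) (hu : ∫⁻ x, u x ∂μ ≠ ∞) :
    a * μ (levelSet μ code u a) ≤ ∫⁻ x, u x ∂μ := by
  obtain ⟨N, hN⟩ := exists_stopping (hG.bddBelow_of_lintegral_ne_top ha hu)
  have := hG.measure_le_of_stopping (hG.stopping_const hN) (ν := a • μ) (ρ := μ.withDensity u)
    (fun x hx => by
      rw [withDensity_apply _ (hG.measurableSet_cell _ _)]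
      exact (hN x hx).1.le)
  calc a * μ (levelSet μ code u a) ≤ (μ.withDensity u) (levelSet μ code u a) := this
    _ ≤ (μ.withDensity u) univ := measure_mono (subset_univ _)
    _ = ∫⁻ x, u x ∂μ := by simp

end Grid

lemma sq_lintegral_le {X : Type*} [MeasurableSpace X] (μ : Measure X) {u : X → ℝ≥0∞}
    (hu : AEMeasurable u μ) : (∫⁻ x, u x ∂μ) ^ 2 ≤ μ univ * ∫⁻ x, u x ^ 2 ∂μ := by
  have h := ENNReal.lintegral_mul_le_Lp_mul_Lq μ Real.HolderConjugate.two_two hu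
    (aemeasurable_const (b := (1 : ℝ≥0∞)))
  simp only [Pi.mul_apply, mul_one, lintegral_const, ENNReal.rpow_two, one_pow, one_mul] at h
  calc (∫⁻ x, u x ∂μ) ^ 2 ≤ ((∫⁻ x, u x ^ 2 ∂μ) ^ (1 / 2 : ℝ) * μ univ ^ (1 / 2 : ℝ)) ^ 2 := by
        gcongr
    _ = μ univ * ∫⁻ x, u x ^ 2 ∂μ := by
        rw [mul_pow, ← ENNReal.rpow_natCast, ← ENNReal.rpow_natCast, ← ENNReal.rpow_mul,
          ← ENNReal.rpow_mul]
        norm_num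
        rw [mul_comm]

section Grid

variable {X ι : Type*} [MeasurableSpace X] {μ : Measure X} {code : ℤ → X → ι} {D : ℝ≥0}

/-- By Cauchy–Schwarz, a cell over which the mean of `u` exceeds `a` is one over which the mean of
`u²` exceeds `a²`. -/
lemma sq_mul_measure_cell_lt {u : X → ℝ≥0∞} (hu : AEMeasurable u μ)
    {a : ℝ≥0∞} {n : ℤ} {x : X}
    (h : a * μ (cell code n x) < ∫⁻ y in cell code n x, u y ∂μ) :
    a ^ 2 * μ (cell code n x) < ∫⁻ y in cell code n x, u y ^ 2 ∂μ := by
  have h0 : μ (cell code n x) ≠ 0 := by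
    intro h0
    rw [Measure.restrict_eq_zero.2 h0] at h
    simp at h
  have h1 := sq_lintegral_le (μ.restrict (cell code n x)) hu.restrict
  rw [Measure.restrict_apply_univ] at h1
  have h2 : (a * μ (cell code n x)) ^ 2 < μ (cell code n x) * ∫⁻ y in cell code n x, u y ^ 2 ∂μ :=
    (ENNReal.pow_lt_pow_left two_ne_zero h).trans_le h1
  have h3 : (a * μ (cell code n x)) ^ 2 = μ (cell code n x) * (a ^ 2 * μ (cell code n x)) := by
    ring
  rw [h3] at h2
  exact lt_of_mul_lt_mul_left' h2

lemma IsGrid.bddBelow_of_sq (hG : IsGrid μ code D) {u : X → ℝ≥0∞} (hu : AEMeasurable u μ)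
    {a : ℝ≥0∞} (ha : a ≠ 0) (hu2 : ∫⁻ x, u x ^ 2 ∂μ ≠ ∞) (x : X) :
    ∃ m₀ : ℤ, ∀ m, a * μ (cell code m x) < ∫⁻ y in cell code m x, u y ∂μ → m₀ ≤ m := by
  obtain ⟨m₀, h⟩ := hG.bddBelow_of_lintegral_ne_top (pow_ne_zero 2 ha) hu2 x
  exact ⟨m₀, fun m hm => h m (sq_mul_measure_cell_lt hu hm)⟩

/-- The weak type `(2,2)` bound for the dyadic maximal function. -/
lemma IsGrid.sq_mul_measure_levelSet_le [Countable ι] (hG : IsGrid μ code D) {u : X → ℝ≥0∞}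
    (hu : AEMeasurable u μ) {a : ℝ≥0∞} (ha : a ≠ 0) (hu2 : ∫⁻ x, u x ^ 2 ∂μ ≠ ∞) :
    a ^ 2 * μ (levelSet μ code u a) ≤ ∫⁻ x, u x ^ 2 ∂μ := by
  refine le_trans ?_ (hG.mul_measure_levelSet_le (pow_ne_zero 2 ha) hu2)
  gcongr
  rintro x ⟨n, hn⟩
  exact ⟨n, sq_mul_measure_cell_lt hu hn⟩

lemma levelSet_anti (μ : Measure X) (code : ℤ → X → ι) (u : X → ℝ≥0∞) {a b : ℝ≥0∞} (h : a ≤ b) :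
    levelSet μ code u b ⊆ levelSet μ code u a := by
  rintro x ⟨n, hn⟩
  exact ⟨n, lt_of_le_of_lt (by gcongr) hn⟩

end Grid

/-! ### The good-`λ` inequality and Lebesgue differentiation along cells -/

lemma sq_eLpNorm_two {X F : Type*} [MeasurableSpace X] [NormedAddCommGroup F] (μ : Measure X)
    (f : X → F) : eLpNorm f 2 μ ^ 2 = ∫⁻ x, ‖f x‖ₑ ^ 2 ∂μ := by
  have := eLpNorm_nnreal_pow_eq_lintegral (f := f) (μ := μ) (p := 2) two_ne_zero
  simpa using this

lemma lintegral_sq_ne_top {X F : Type*} [MeasurableSpace X] [NormedAddCommGroup F]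
    {μ : Measure X} {f : X → F} (hf : MemLp f 2 μ) : ∫⁻ x, ‖f x‖ₑ ^ 2 ∂μ ≠ ∞ := by
  rw [← sq_eLpNorm_two]
  exact ENNReal.pow_ne_top hf.eLpNorm_ne_top

section Grid

variable {X ι 𝕜 : Type*} [MeasurableSpace X] {μ : Measure X} {code : ℤ → X → ι} {D : ℝ≥0}
  [RCLike 𝕜]

lemma enorm_setAverage_le {g : X → 𝕜} {s : Set X} {a : ℝ≥0∞} (h0 : μ s ≠ 0) (h1 : μ s ≠ ∞)
    (h : ∫⁻ x in s, ‖g x‖ₑ ∂μ ≤ a * μ s) : ‖⨍ x in s, g x ∂μ‖ₑ ≤ a := by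
  rw [setAverage_eq, enorm_smul, Real.enorm_eq_ofReal (by positivity), measureReal_def,
    ENNReal.ofReal_inv_of_pos (ENNReal.toReal_pos h0 h1), ENNReal.ofReal_toReal h1]
  calc (μ s)⁻¹ * ‖∫ x in s, g x ∂μ‖ₑ ≤ (μ s)⁻¹ * (a * μ s) := by
        gcongr
        exact (enorm_integral_le_lintegral_enorm _).trans h
    _ = a * ((μ s)⁻¹ * μ s) := by ring
    _ = a := by rw [ENNReal.inv_mul_cancel h0 h1, mul_one]

/-- The good-`λ` inequality: if on each cell the mean oscillation of `g` is at most `c` plus twice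
the mean of `v`, then the part of `{M g > 2a}` on which `M v ≤ b` fills at most the fraction
`D (c + 2b) / a` of `{M g > a}`. On a maximal cell `Q` of `{M g > a}` with parent `P`, the mean
`g_P` is at most `a`, so that `M g > 2a` forces `M ((g - g_P) 1_Q) > a`, and the weak type
`(1,1)` bound applies. -/
lemma IsGrid.good_lambda [Countable ι] (hG : IsGrid μ code D) {g : X → 𝕜} (hg : MemLp g 2 μ)
    {v : X → ℝ≥0∞} {a b c : ℝ≥0∞} (ha : a ≠ 0) (hb : b ≠ ∞) (hc : c ≠ ∞)
    (hosc : ∀ n x, ∫⁻ y in cell code n x, ‖g y - ⨍ z in cell code n x, g z ∂μ‖ₑ ∂μ ≤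
      c * μ (cell code n x) + 2 * ∫⁻ y in cell code n x, v y ∂μ) :
    a * μ (levelSet μ code (fun x => ‖g x‖ₑ) (2 * a) \ levelSet μ code v b) ≤
      D * (c + 2 * b) * μ (levelSet μ code (fun x => ‖g x‖ₑ) a) := by
  set u : X → ℝ≥0∞ := fun x => ‖g x‖ₑ with hu
  set B := levelSet μ code u (2 * a) \ levelSet μ code v b with hB
  have hBE : B ⊆ levelSet μ code u a := fun x hx =>
    levelSet_anti μ code u (le_mul_of_one_le_left' one_le_two) hx.1
  obtain ⟨N, hN⟩ := exists_stopping
    (hG.bddBelow_of_sq hg.aestronglyMeasurable.enorm ha (lintegral_sq_ne_top hg))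
  have key : ∀ x ∈ levelSet μ code u a,
      (a • μ.restrict B) (cell code (N x) x) ≤
        ((D * (c + 2 * b)) • μ) (cell code (N x) x) := by
    intro x hx
    simp only [Measure.smul_apply, smul_eq_mul]
    rw [Measure.restrict_apply (hG.measurableSet_cell _ _)]
    set Q := cell code (N x) x with hQ
    set P := cell code (N x - 1) x with hP
    have hQP : Q ⊆ P := hG.cell_subset (by omega) x
    have hQ0 : μ Q ≠ 0 := by
      intro h0
      have := (hN x hx).1
      rw [← hQ, Measure.restrict_eq_zero.2 h0] at this
      simp at this
    have hP0 : μ P ≠ 0 := fun h => hQ0 (measure_mono_null hQP h)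
    have hPg : ∫⁻ y in P, ‖g y‖ₑ ∂μ ≤ a * μ P := by
      by_contra hlt
      have := (hN x hx).2 (N x - 1) (not_le.1 hlt)
      omega
    have hgP := enorm_setAverage_le hP0 (hG.finite _ _) hPg
    -- unless `Q` is contained in the level set of `v`, a point outside it bounds the mean over `P`
    by_cases hQB : (Q ∩ B) = ∅
    · simp [hQB]
    obtain ⟨y, hyQ, hyB⟩ := nonempty_iff_ne_empty.2 hQB
    have hyP : cell code (N x - 1) y = P := cell_eq_of_mem (hQP hyQ)
    have hPv : ∫⁻ y in P, v y ∂μ ≤ b * μ P := by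
      by_contra hlt
      exact hyB.2 ⟨N x - 1, by rw [hyP]; exact not_le.1 hlt⟩
    set w : X → ℝ≥0∞ := Q.indicator fun y => ‖g y - ⨍ z in P, g z ∂μ‖ₑ with hw
    have hwint : ∫⁻ y, w y ∂μ ≤ (c + 2 * b) * μ P := by
      rw [hw, lintegral_indicator (hG.measurableSet_cell _ _)]
      calc _ ≤ ∫⁻ y in P, ‖g y - ⨍ z in P, g z ∂μ‖ₑ ∂μ := lintegral_mono_set hQP
        _ ≤ c * μ P + 2 * ∫⁻ y in P, v y ∂μ := hosc _ _
        _ ≤ c * μ P + 2 * (b * μ P) := by gcongr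
        _ = (c + 2 * b) * μ P := by ring
    have hwtop : ∫⁻ y, w y ∂μ ≠ ∞ := by
      refine ne_top_of_le_ne_top ?_ hwint
      have := hG.finite (N x - 1) x
      finiteness
    -- a cell over which the mean of `|g|` exceeds `2a` lies inside `Q`, by maximality of `Q`
    have hsub : Q ∩ B ⊆ levelSet μ code w a := by
      rintro z ⟨hzQ, hzB⟩
      obtain ⟨n, hn⟩ := hzB.1
      have hz := hG.stopping_const hN x hx z hzQ
      have hnN : N x ≤ n := by
        rw [← hz.2]
        refine (hN z hz.1).2 n (lt_of_le_of_lt ?_ hn)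
        gcongr
        exact le_mul_of_one_le_left' one_le_two
      have hsubQ : cell code n z ⊆ Q := by
        rw [hQ, ← cell_eq_of_mem hzQ]
        exact hG.cell_subset hnN z
      refine ⟨n, ?_⟩
      have h1 : ∫⁻ y in cell code n z, w y ∂μ =
          ∫⁻ y in cell code n z, ‖g y - ⨍ z in P, g z ∂μ‖ₑ ∂μ :=
        setLIntegral_congr_fun (hG.measurableSet_cell _ _) fun y hy =>
          indicator_of_mem (hsubQ hy) _
      rw [h1]
      have h2 : ∫⁻ y in cell code n z, u y ∂μ ≤
          ∫⁻ y in cell code n z, ‖g y - ⨍ z in P, g z ∂μ‖ₑ ∂μ + a * μ (cell code n z) := by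
        calc _ ≤ ∫⁻ y in cell code n z, (‖g y - ⨍ z in P, g z ∂μ‖ₑ + a) ∂μ := by
              refine lintegral_mono fun y => ?_
              calc ‖g y‖ₑ = ‖(g y - ⨍ z in P, g z ∂μ) + ⨍ z in P, g z ∂μ‖ₑ := by simp
                _ ≤ _ := (enorm_add_le _ _).trans (by gcongr)
          _ = _ := by rw [lintegral_add_right _ measurable_const, setLIntegral_const]
      have h3 : a * μ (cell code n z) + a * μ (cell code n z) <
          ∫⁻ y in cell code n z, ‖g y - ⨍ z in P, g z ∂μ‖ₑ ∂μ + a * μ (cell code n z) := by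
        refine lt_of_lt_of_le ?_ h2
        rwa [← two_mul, ← mul_assoc]
      exact lt_of_add_lt_add_right h3
    calc a * μ (Q ∩ B) ≤ a * μ (levelSet μ code w a) := by gcongr
      _ ≤ ∫⁻ y, w y ∂μ := hG.mul_measure_levelSet_le ha hwtop
      _ ≤ (c + 2 * b) * μ P := hwint
      _ ≤ (c + 2 * b) * (D * μ Q) := by gcongr; exact hG.doubling _ _
      _ = D * (c + 2 * b) * μ Q := by ring
  have := hG.measure_le_of_stopping (hG.stopping_const hN) key
  refine le_trans ?_ this
  simp only [Measure.smul_apply, smul_eq_mul]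
  refine mul_le_mul' le_rfl ?_
  calc μ B = μ (levelSet μ code u a ∩ B) := by rw [inter_eq_right.2 hBE]
    _ ≤ _ := Measure.le_restrict_apply _ _

/-- A form of the Lebesgue differentiation theorem along the cells: `|g|` is at most the dyadic
maximal function of `g` almost everywhere. -/
lemma IsGrid.measure_lt_enorm_le [Countable ι] (hG : IsGrid μ code D) [TopologicalSpace X]
    [NormalSpace X] [BorelSpace X] [μ.WeaklyRegular]
    (hshrink : ∀ x, ∀ V ∈ 𝓝 x, ∃ n, cell code n x ⊆ V) {g : X → 𝕜} (hg : MemLp g 2 μ)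
    (a : ℝ≥0∞) :
    μ {x | a < ‖g x‖ₑ} ≤ μ (levelSet μ code (fun x => ‖g x‖ₑ) a) := by
  set E := levelSet μ code (fun x => ‖g x‖ₑ) a
  have key : ∀ η : ℝ≥0∞, η ≠ 0 → η ≠ ∞ → μ ({x | a + 3 * η < ‖g x‖ₑ} \ E) = 0 := by
    intro η hη hη'
    have hδ : ∀ δ : ℝ≥0∞, δ ≠ 0 → η ^ 2 * μ ({x | a + 3 * η < ‖g x‖ₑ} \ E) ≤ 2 * δ ^ 2 := by
      intro δ hδ
      -- where the error `w = g - v` is small, `|v|` exceeds `a + 2η` on a whole cell, so that the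
      -- mean of `|w|` over that cell exceeds `η` unless the mean of `|g|` exceeds `a`
      obtain ⟨v, hv, hv2⟩ := hg.exists_boundedContinuous_eLpNorm_sub_le (by simp) hδ
      set w : X → 𝕜 := g - ⇑v with hw
      have hwL : MemLp w 2 μ := hg.sub hv2
      have hwint : ∫⁻ x, ‖w x‖ₑ ^ 2 ∂μ ≤ δ ^ 2 := by
        rw [← sq_eLpNorm_two]
        gcongr
      have hsub : ∀ᵐ x ∂μ, x ∈ {x | a + 3 * η < ‖g x‖ₑ} \ E →
          x ∈ {x | η ^ 2 ≤ ‖w x‖ₑ ^ 2} ∪ levelSet μ code (fun x => ‖w x‖ₑ) η := by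
        filter_upwards [hG.ae_cell_ne_zero] with x hx0 ⟨hx1, hx2⟩
        by_cases hxw : η ≤ ‖w x‖ₑ
        · exact Or.inl (pow_le_pow_left' hxw 2)
        right
        have hvx : a + 2 * η < ‖v x‖ₑ := by
          have h1 : ‖g x‖ₑ ≤ ‖w x‖ₑ + ‖v x‖ₑ := by
            calc ‖g x‖ₑ = ‖w x + v x‖ₑ := by simp [hw]
              _ ≤ _ := enorm_add_le _ _
          have h2 : η + (a + 2 * η) < η + ‖v x‖ₑ := by
            calc η + (a + 2 * η) = a + 3 * η := by ring
              _ < ‖g x‖ₑ := hx1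
              _ ≤ _ := h1.trans (by gcongr; exact (not_le.1 hxw).le)
          exact lt_of_add_lt_add_left h2
        obtain ⟨n, hn⟩ := hshrink x _ (v.continuous.enorm.continuousAt.eventually
          (lt_mem_nhds hvx))
        refine ⟨n, ?_⟩
        have h1 : (a + 2 * η) * μ (cell code n x) ≤ ∫⁻ y in cell code n x, ‖v y‖ₑ ∂μ := by
          rw [← setLIntegral_const]
          exact setLIntegral_mono' (hG.measurableSet_cell _ _) fun y hy => (hn hy).le
        have h2 : ∫⁻ y in cell code n x, ‖v y‖ₑ ∂μ ≤
            ∫⁻ y in cell code n x, ‖g y‖ₑ ∂μ + ∫⁻ y in cell code n x, ‖w y‖ₑ ∂μ := by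
          rw [← lintegral_add_right' _ hwL.aestronglyMeasurable.enorm.restrict]
          refine lintegral_mono fun y => ?_
          calc ‖v y‖ₑ = ‖g y - w y‖ₑ := by simp [hw]
            _ ≤ _ := enorm_sub_le
        have h3 : ∫⁻ y in cell code n x, ‖g y‖ₑ ∂μ ≤ a * μ (cell code n x) := by
          by_contra hlt
          exact hx2 ⟨n, not_le.1 hlt⟩
        have h4 : a * μ (cell code n x) + 2 * η * μ (cell code n x) ≤
            a * μ (cell code n x) + ∫⁻ y in cell code n x, ‖w y‖ₑ ∂μ := by
          rw [← add_mul]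
          exact h1.trans (h2.trans (by gcongr))
        have ha : a ≠ ∞ := by
          rintro rfl
          simp at hx1
        have h5 := ENNReal.le_of_add_le_add_left (ENNReal.mul_ne_top ha (hG.finite n x)) h4
        refine lt_of_lt_of_le ?_ h5
        rw [mul_assoc, two_mul]
        refine ENNReal.lt_add_right (ENNReal.mul_ne_top hη' (hG.finite n x)) ?_
        exact mul_ne_zero hη (hx0 n)
      calc η ^ 2 * μ ({x | a + 3 * η < ‖g x‖ₑ} \ E)
          ≤ η ^ 2 * (μ {x | η ^ 2 ≤ ‖w x‖ₑ ^ 2} + μ (levelSet μ code (fun x => ‖w x‖ₑ) η)) := by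
            gcongr
            exact (measure_mono_ae hsub).trans (measure_union_le _ _)
        _ ≤ δ ^ 2 + δ ^ 2 := by
            rw [mul_add]
            gcongr
            · exact (mul_meas_ge_le_lintegral₀
                (hwL.aestronglyMeasurable.enorm.pow_const 2) _).trans hwint
            · exact (hG.sq_mul_measure_levelSet_le hwL.aestronglyMeasurable.enorm hη
                (lintegral_sq_ne_top hwL)).trans hwint
        _ = 2 * δ ^ 2 := by ring
    have hlim : Tendsto (fun n : ℕ => 2 * ((n : ℝ≥0∞)⁻¹) ^ 2) atTop (𝓝 (2 * 0 ^ 2)) :=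
      ENNReal.Tendsto.const_mul (ENNReal.Tendsto.pow ENNReal.tendsto_inv_nat_nhds_zero)
        (Or.inr (by simp))
    have h0 := ge_of_tendsto' hlim fun n => hδ (n : ℝ≥0∞)⁻¹ (by simp)
    have h1 : η ^ 2 * μ ({x | a + 3 * η < ‖g x‖ₑ} \ E) = 0 := by simpa using h0
    rcases mul_eq_zero.1 h1 with h | h
    · exact absurd h (pow_ne_zero 2 hη)
    · exact h
  have hcover : {x | a < ‖g x‖ₑ} ⊆
      E ∪ ⋃ n : ℕ, ({x | a + 3 * ((n : ℝ≥0∞) + 1)⁻¹ < ‖g x‖ₑ} \ E) := by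
    intro x hx
    by_cases hxE : x ∈ E
    · exact Or.inl hxE
    right
    have hlim : Tendsto (fun n : ℕ => a + 3 * ((n : ℝ≥0∞) + 1)⁻¹) atTop (𝓝 (a + 3 * 0)) := by
      refine Tendsto.add tendsto_const_nhds (ENNReal.Tendsto.const_mul ?_ (Or.inr (by simp)))
      have := (tendsto_add_atTop_iff_nat 1).2 ENNReal.tendsto_inv_nat_nhds_zero
      simpa using this
    rw [mul_zero, add_zero] at hlim
    obtain ⟨n, hn⟩ := (hlim.eventually (gt_mem_nhds hx)).exists
    exact mem_iUnion.2 ⟨n, hn, hxE⟩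
  calc μ {x | a < ‖g x‖ₑ} ≤ μ E + μ (⋃ n : ℕ, ({x | a + 3 * ((n : ℝ≥0∞) + 1)⁻¹ < ‖g x‖ₑ} \ E)) :=
        (measure_mono hcover).trans (measure_union_le _ _)
    _ = μ E := by
        rw [measure_iUnion_null fun n => key _ (by simp) (by simp), add_zero]

end Grid

/-! ### Integrating the good-`λ` inequality -/

lemma lintegral_Ioc_comp_two_mul {F : ℝ → ℝ≥0∞} (hF : Measurable F) (R : ℝ) :
    ∫⁻ t in Ioc 0 (2 * R), F t = 2 * ∫⁻ t in Ioc 0 R, F (2 * t) := by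
  rw [← lintegral_indicator measurableSet_Ioc, ← lintegral_indicator measurableSet_Ioc]
  conv_lhs => rw [← Real.smul_map_volume_mul_left (two_ne_zero (α := ℝ))]
  rw [lintegral_smul_measure, lintegral_map (hF.indicator measurableSet_Ioc) (by fun_prop)]
  simp only [abs_two, ENNReal.ofReal_ofNat, smul_eq_mul]
  congr 2
  ext t
  simp only [indicator, mem_Ioc]
  congr 1
  simp

/-- Integration of a good-`λ` inequality `e (2t) ≤ θ e(t) + b(t)`: if `2^p θ ≤ 1/2`, the first term
on the right is absorbed. The integrals over bounded intervals have to be finite a priori. -/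
lemma lintegral_le_of_good_lambda {p : ℝ} {e b : ℝ → ℝ≥0∞} (he : Antitone e)
    (hb : Measurable b) {θ : ℝ≥0∞} (hθ : ENNReal.ofReal (2 ^ p) * θ ≤ 1 / 2)
    (hrec : ∀ t, 0 < t → e (2 * t) ≤ θ * e t + b t)
    (hfin : ∀ R, 0 < R → ∫⁻ t in Ioc 0 R, e t * ENNReal.ofReal (t ^ (p - 1)) ≠ ∞) :
    ∫⁻ t in Ioi 0, e t * ENNReal.ofReal (t ^ (p - 1)) ≤
      2 * (ENNReal.ofReal (2 ^ p) * ∫⁻ t in Ioi 0, b t * ENNReal.ofReal (t ^ (p - 1))) := by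
  set W : ℝ → ℝ≥0∞ := fun t => ENNReal.ofReal (t ^ (p - 1)) with hW
  have hWm : Measurable W := by fun_prop
  have hem : Measurable fun t => e t * W t := he.measurable.mul hWm
  have hbm : Measurable fun t => b t * W t := hb.mul hWm
  set B := ∫⁻ t in Ioi 0, b t * W t
  have key : ∀ R, 0 < R → ∫⁻ t in Ioc 0 (2 * R), e t * W t ≤ 2 * (ENNReal.ofReal (2 ^ p) * B) := by
    intro R hR
    set I := ∫⁻ t in Ioc 0 (2 * R), e t * W t with hI
    have hItop : I ≠ ∞ := hfin _ (by linarith)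
    have h1 : I ≤ 1 / 2 * I + ENNReal.ofReal (2 ^ p) * B := by
      calc I = 2 * ∫⁻ t in Ioc 0 R, e (2 * t) * W (2 * t) := lintegral_Ioc_comp_two_mul hem R
        _ = ENNReal.ofReal (2 ^ p) * ∫⁻ t in Ioc 0 R, e (2 * t) * W t := by
          have h2 : ∀ t ∈ Ioc 0 R, e (2 * t) * W (2 * t) =
              ENNReal.ofReal (2 ^ (p - 1)) * (e (2 * t) * W t) := by
            intro t ht
            simp only [hW]
            rw [Real.mul_rpow zero_le_two ht.1.le, ENNReal.ofReal_mul (by positivity)]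
            ring
          rw [setLIntegral_congr_fun measurableSet_Ioc h2, lintegral_const_mul', ← mul_assoc]
          · congr 1
            rw [Real.rpow_sub_one two_ne_zero, ← ENNReal.ofReal_ofNat 2,
              ← ENNReal.ofReal_mul zero_le_two]
            congr 1
            ring
          · exact ENNReal.ofReal_ne_top
        _ ≤ ENNReal.ofReal (2 ^ p) * ∫⁻ t in Ioc 0 R, (θ * (e t * W t) + b t * W t) := by
          refine mul_le_mul' le_rfl (setLIntegral_mono' measurableSet_Ioc fun t ht => ?_)
          calc e (2 * t) * W t ≤ (θ * e t + b t) * W t := by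
                gcongr
                exact hrec t ht.1
            _ = _ := by ring
        _ = ENNReal.ofReal (2 ^ p) * (θ * (∫⁻ t in Ioc 0 R, e t * W t) +
              ∫⁻ t in Ioc 0 R, b t * W t) := by
          rw [lintegral_add_right _ hbm, lintegral_const_mul _ hem]
        _ ≤ ENNReal.ofReal (2 ^ p) * (θ * I + B) := by
          gcongr
          · exact lintegral_mono_set (Ioc_subset_Ioc_right (by linarith))
          · exact lintegral_mono_set Ioc_subset_Ioi_self
        _ = (ENNReal.ofReal (2 ^ p) * θ) * I + ENNReal.ofReal (2 ^ p) * B := by ring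
        _ ≤ _ := by gcongr
    have h3 : 1 / 2 * I + 1 / 2 * I ≤ 1 / 2 * I + ENNReal.ofReal (2 ^ p) * B := by
      rwa [← add_mul, ENNReal.add_halves, one_mul]
    have h4 := ENNReal.le_of_add_le_add_left (by finiteness) h3
    calc I = 2 * (1 / 2 * I) := by
          rw [← mul_assoc, one_div, ENNReal.mul_inv_cancel two_ne_zero (by simp), one_mul]
      _ ≤ _ := by gcongr
  have hU : Ioi (0 : ℝ) = ⋃ n : ℕ, Ioc 0 (2 * ((n : ℝ) + 1)) := by
    ext t
    simp only [mem_Ioi, mem_iUnion, mem_Ioc, exists_and_left]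
    refine ⟨fun ht => ⟨ht, ?_⟩, fun h => h.1⟩
    obtain ⟨n, hn⟩ := exists_nat_ge t
    exact ⟨n, by linarith [n.cast_nonneg (α := ℝ)]⟩
  have hmono : Monotone fun n : ℕ => Ioc 0 (2 * ((n : ℝ) + 1)) := fun m n hmn =>
    Ioc_subset_Ioc_right (by gcongr)
  rw [hU, setLIntegral_iUnion_of_directed _ hmono.directed_le]
  exact iSup_le fun n => key _ (by positivity)

lemma lintegral_Ioc_rpow_ne_top {q : ℝ} (hq : -1 < q) {R : ℝ} (hR : 0 < R) :
    ∫⁻ t in Ioc 0 R, ENNReal.ofReal (t ^ q) ≠ ∞ := by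
  have h := (intervalIntegrable_iff_integrableOn_Ioc_of_le hR.le).1
    (intervalIntegral.intervalIntegrable_rpow' (a := 0) (b := R) hq)
  exact (h.lintegral_lt_top).ne

section Grid

variable {X ι 𝕜 : Type*} [MeasurableSpace X] {μ : Measure X} {code : ℤ → X → ι} {D : ℝ≥0}
  [RCLike 𝕜]

/-- The layer cake formula for `∫ |f|^p` in terms of the measure `|f|² dμ`. -/
lemma lintegral_rpow_eq_layercake {p : ℝ} (hp : 2 < p) {f : X → 𝕜} (hf : Measurable f) {γ : ℝ}
    (hγ : 0 < γ) :
    ENNReal.ofReal (p - 2) * ∫⁻ t in Ioi 0, ENNReal.ofReal ((γ * t) ^ 2)⁻¹ *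
        (∫⁻ x in {x | γ * t < ‖f x‖}, ‖f x‖ₑ ^ 2 ∂μ) * ENNReal.ofReal (t ^ (p - 1)) =
      ENNReal.ofReal (γ ^ (-p)) * ∫⁻ x, ‖f x‖ₑ ^ p ∂μ := by
  set ν := μ.withDensity fun x => ‖f x‖ₑ ^ 2 with hν
  have h := lintegral_rpow_eq_lintegral_meas_lt_mul ν (f := fun x => ‖f x‖ / γ)
    (Eventually.of_forall fun x => by positivity) (by fun_prop) (p := p - 2) (by linarith)
  have h1 : ∀ t ∈ Ioi (0 : ℝ), ENNReal.ofReal ((γ * t) ^ 2)⁻¹ *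
      (∫⁻ x in {x | γ * t < ‖f x‖}, ‖f x‖ₑ ^ 2 ∂μ) * ENNReal.ofReal (t ^ (p - 1)) =
      ENNReal.ofReal (γ ^ 2)⁻¹ * (ν {x | t < ‖f x‖ / γ} * ENNReal.ofReal (t ^ (p - 2 - 1))) := by
    intro t ht
    have ht : 0 < t := ht
    have hset : {x | t < ‖f x‖ / γ} = {x | γ * t < ‖f x‖} := by
      ext x
      change t < ‖f x‖ / γ ↔ γ * t < ‖f x‖
      rw [lt_div_iff₀ hγ, mul_comm]
    have hms : MeasurableSet {x | γ * t < ‖f x‖} := measurableSet_lt measurable_const hf.norm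
    have ht2 : ENNReal.ofReal ((γ * t) ^ 2)⁻¹ * ENNReal.ofReal (t ^ (p - 1)) =
        ENNReal.ofReal (γ ^ 2)⁻¹ * ENNReal.ofReal (t ^ (p - 2 - 1)) := by
      rw [← ENNReal.ofReal_mul (by positivity), ← ENNReal.ofReal_mul (by positivity)]
      congr 1
      have : t ^ (p - 1) = t ^ (p - 2 - 1) * t ^ 2 := by
        rw [← Real.rpow_natCast, ← Real.rpow_add ht]
        congr 1
        push_cast
        ring
      rw [this]
      field_simp
    rw [hset, hν, withDensity_apply _ hms, mul_right_comm, ht2]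
    ring
  rw [setLIntegral_congr_fun measurableSet_Ioi h1, lintegral_const_mul' _ _ ENNReal.ofReal_ne_top,
    mul_left_comm, ← h, hν, lintegral_withDensity_eq_lintegral_mul _ (by fun_prop) (by fun_prop),
    ← lintegral_const_mul' _ _ ENNReal.ofReal_ne_top,
    ← lintegral_const_mul' _ _ ENNReal.ofReal_ne_top]
  refine lintegral_congr fun x => ?_
  simp only [Pi.mul_apply]
  rw [← ofReal_norm, ← ENNReal.ofReal_pow (norm_nonneg _),
    ENNReal.ofReal_rpow_of_nonneg (norm_nonneg _) (by linarith),
    ← ENNReal.ofReal_mul (by positivity), ← ENNReal.ofReal_mul (by positivity),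
    ← ENNReal.ofReal_mul (by positivity)]
  congr 1
  rcases (norm_nonneg (f x)).eq_or_lt with h0 | h0
  · rw [← h0, Real.zero_rpow (by linarith)]
    simp
  · rw [Real.div_rpow h0.le hγ.le, Real.rpow_neg hγ.le]
    have e1 : ‖f x‖ ^ p = ‖f x‖ ^ (p - 2) * ‖f x‖ ^ 2 := by
      rw [← Real.rpow_natCast, ← Real.rpow_add h0]
      congr 1
      push_cast
      ring
    have e2 : γ ^ p = γ ^ (p - 2) * γ ^ 2 := by
      rw [← Real.rpow_natCast, ← Real.rpow_add hγ]
      congr 1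
      push_cast
      ring
    rw [e1, e2]
    have := Real.rpow_pos_of_pos hγ (p - 2)
    field_simp

/-- Interpolation between `L_2` and `BMO` on a grid: suppose that for each height `h` the mean
oscillations of `g` over the cells are at most `C h`, up to twice the means of a function `v`
whose `L_2` norm is controlled by that of `f` over `{|f| > h}`. Then the `L_p` norm of `g`, `p > 2`,
is controlled by that of `f`. -/
theorem IsGrid.lintegral_rpow_le [Countable ι] (hG : IsGrid μ code D) [TopologicalSpace X]
    [NormalSpace X] [BorelSpace X] [μ.WeaklyRegular]
    (hshrink : ∀ x, ∀ V ∈ 𝓝 x, ∃ n, cell code n x ⊆ V) {p : ℝ} (hp : 2 < p) (C C₂ : ℝ≥0) :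
    ∃ A : ℝ≥0, ∀ f g : X → 𝕜, Measurable f → MemLp f 2 μ → MemLp g 2 μ →
      (∀ h : ℝ, 0 < h → ∃ v : X → ℝ≥0∞, AEMeasurable v μ ∧
        ∫⁻ x, v x ^ 2 ∂μ ≤ C₂ * ∫⁻ x in {x | h < ‖f x‖}, ‖f x‖ₑ ^ 2 ∂μ ∧
        ∀ n x, ∫⁻ y in cell code n x, ‖g y - ⨍ z in cell code n x, g z ∂μ‖ₑ ∂μ ≤
          C * ENNReal.ofReal h * μ (cell code n x) + 2 * ∫⁻ y in cell code n x, v y ∂μ) →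
      ∫⁻ x, ‖g x‖ₑ ^ p ∂μ ≤ A * ∫⁻ x, ‖f x‖ₑ ^ p ∂μ := by
  -- the height `γ t`, with `γ` small enough for the absorption of the good-`λ` term
  set γ : ℝ := 1 / (2 * 2 ^ p * ((D + 1) * (C + 2))) with hγ
  have hγ0 : 0 < γ := by positivity
  refine ⟨Real.toNNReal (p * (2 * (2 ^ p * (C₂ * (γ ^ (-p) / (p - 2)))))), ?_⟩
  intro f g hf hf2 hg hdec
  set u : X → ℝ≥0∞ := fun x => ‖g x‖ₑ with hu
  have hum : AEMeasurable u μ := hg.aestronglyMeasurable.enorm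
  set e : ℝ → ℝ≥0∞ := fun t => μ (levelSet μ code u (ENNReal.ofReal t)) with he
  set b : ℝ → ℝ≥0∞ := fun t => C₂ * (ENNReal.ofReal ((γ * t) ^ 2)⁻¹ *
    ∫⁻ x in {x | γ * t < ‖f x‖}, ‖f x‖ₑ ^ 2 ∂μ) with hb
  have hlevel : ∀ t : ℝ, 0 < t → e t ≤
      (∫⁻ x, ‖g x‖ₑ ^ 2 ∂μ) * (ENNReal.ofReal t ^ 2)⁻¹ := by
    intro t ht
    have ht0 : ENNReal.ofReal t ≠ 0 := by simpa using ht
    rw [← div_eq_mul_inv, ENNReal.le_div_iff_mul_le (Or.inl (pow_ne_zero 2 ht0))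
      (Or.inl (by finiteness)), mul_comm]
    exact hG.sq_mul_measure_levelSet_le hum ht0 (lintegral_sq_ne_top hg)
  have he_anti : Antitone e := fun s t hst =>
    measure_mono (levelSet_anti μ code u (ENNReal.ofReal_le_ofReal hst))
  have hb_meas : Measurable b := by
    have : Antitone fun t : ℝ => ∫⁻ x in {x | γ * t < ‖f x‖}, ‖f x‖ₑ ^ 2 ∂μ :=
      fun s t hst => lintegral_mono_set fun x hx =>
        lt_of_le_of_lt (mul_le_mul_of_nonneg_left hst hγ0.le) hx
    have := this.measurable
    fun_prop
  have hrec : ∀ t, 0 < t → e (2 * t) ≤ ENNReal.ofReal (D * (C + 2) * γ) * e t + b t := by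
    intro t ht
    have hγt : 0 < γ * t := by positivity
    obtain ⟨v, hv, hv2, hosc⟩ := hdec (γ * t) hγt
    have ht0 : ENNReal.ofReal t ≠ 0 := by simpa using ht
    have hs0 : ENNReal.ofReal (γ * t) ≠ 0 := by simpa using hγt
    have hvtop : ∫⁻ x, v x ^ 2 ∂μ ≠ ∞ :=
      ne_top_of_le_ne_top (ENNReal.mul_ne_top ENNReal.coe_ne_top (ne_top_of_le_ne_top
        (lintegral_sq_ne_top hf2) (setLIntegral_le_lintegral _ _))) hv2
    have h1 := hG.good_lambda hg ht0 (b := ENNReal.ofReal (γ * t)) (by finiteness)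
      (c := C * ENNReal.ofReal (γ * t)) (by finiteness) hosc
    have h2 : μ (levelSet μ code u (2 * ENNReal.ofReal t) \
        levelSet μ code v (ENNReal.ofReal (γ * t))) ≤
        ENNReal.ofReal (D * (C + 2) * γ) * e t := by
      rw [← ENNReal.mul_le_mul_iff_right ht0 ENNReal.ofReal_ne_top]
      refine h1.trans (le_of_eq ?_)
      rw [ENNReal.ofReal_mul hγ0.le, ENNReal.ofReal_mul (by positivity),
        ENNReal.ofReal_mul (by positivity), ENNReal.ofReal_add (by positivity) zero_le_two,
        ENNReal.ofReal_coe_nnreal, ENNReal.ofReal_coe_nnreal, ENNReal.ofReal_ofNat]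
      ring
    have h3 : μ (levelSet μ code v (ENNReal.ofReal (γ * t))) ≤ b t := by
      have h4 := hG.sq_mul_measure_levelSet_le hv hs0 hvtop
      rw [mul_comm, ← ENNReal.le_div_iff_mul_le (Or.inl (pow_ne_zero 2 hs0))
        (Or.inl (by finiteness))] at h4
      refine h4.trans ?_
      simp only [hb]
      rw [div_eq_mul_inv, ENNReal.ofReal_inv_of_pos (by positivity),
        ENNReal.ofReal_pow hγt.le]
      calc _ ≤ (C₂ * ∫⁻ x in {x | γ * t < ‖f x‖}, ‖f x‖ₑ ^ 2 ∂μ) *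
            (ENNReal.ofReal (γ * t) ^ 2)⁻¹ := by gcongr
        _ = _ := by ring
    calc e (2 * t) = μ (levelSet μ code u (2 * ENNReal.ofReal t)) := by
          simp only [he]
          rw [ENNReal.ofReal_mul zero_le_two, ENNReal.ofReal_ofNat]
      _ ≤ μ (levelSet μ code u (2 * ENNReal.ofReal t) \
            levelSet μ code v (ENNReal.ofReal (γ * t))) +
          μ (levelSet μ code v (ENNReal.ofReal (γ * t))) := by
          rw [add_comm]
          exact (measure_mono (by rw [union_sdiff_self]; exact subset_union_right)).trans
            (measure_union_le _ _)
      _ ≤ _ := add_le_add h2 h3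
  have hθ : ENNReal.ofReal (2 ^ p) * ENNReal.ofReal (D * (C + 2) * γ) ≤ 1 / 2 := by
    rw [← ENNReal.ofReal_mul (by positivity)]
    calc ENNReal.ofReal (2 ^ p * (D * (C + 2) * γ)) ≤ ENNReal.ofReal (1 / 2) := by
          refine ENNReal.ofReal_le_ofReal ?_
          rw [hγ]
          have : (0 : ℝ) < 2 ^ p := by positivity
          field_simp
          have : (0 : ℝ) ≤ D := D.2
          linarith
      _ = 1 / 2 := by simp
  -- finite because `e t ≤ ‖g‖² / t²` and `t^(p-3)` is integrable at `0` for `p > 2`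
  have hfin : ∀ R, 0 < R → ∫⁻ t in Ioc 0 R, e t * ENNReal.ofReal (t ^ (p - 1)) ≠ ∞ := by
    intro R hR
    have h1 : ∫⁻ t in Ioc 0 R, e t * ENNReal.ofReal (t ^ (p - 1)) ≤
        ∫⁻ t in Ioc 0 R, (∫⁻ x, ‖g x‖ₑ ^ 2 ∂μ) * ENNReal.ofReal (t ^ (p - 3)) := by
      refine setLIntegral_mono' measurableSet_Ioc fun t ht => ?_
      have ht0 : 0 < t := ht.1
      calc e t * ENNReal.ofReal (t ^ (p - 1)) ≤ (∫⁻ x, ‖g x‖ₑ ^ 2 ∂μ) *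
            (ENNReal.ofReal t ^ 2)⁻¹ * ENNReal.ofReal (t ^ (p - 1)) := by
            gcongr
            exact hlevel t ht0
        _ = _ := by
            rw [mul_assoc, ← ENNReal.ofReal_pow ht0.le, ← ENNReal.ofReal_inv_of_pos (by positivity),
              ← ENNReal.ofReal_mul (by positivity)]
            congr 2
            have : t ^ (p - 1) = t ^ (p - 3) * t ^ 2 := by
              rw [← Real.rpow_natCast, ← Real.rpow_add ht0]
              congr 1
              push_cast
              ring
            rw [this]
            field_simp
    refine ne_top_of_le_ne_top ?_ h1
    rw [lintegral_const_mul' _ _ (lintegral_sq_ne_top hg)]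
    exact ENNReal.mul_ne_top (lintegral_sq_ne_top hg)
      (lintegral_Ioc_rpow_ne_top (by linarith) hR)
  have hmain := lintegral_le_of_good_lambda he_anti hb_meas hθ hrec hfin
  have hlayer : ∫⁻ x, ‖g x‖ₑ ^ p ∂μ =
      ENNReal.ofReal p * ∫⁻ t in Ioi 0, μ {x | t < ‖g x‖} * ENNReal.ofReal (t ^ (p - 1)) := by
    rw [← lintegral_rpow_eq_lintegral_meas_lt_mul μ (Eventually.of_forall fun x => norm_nonneg _)
      hg.aestronglyMeasurable.norm.aemeasurable (by linarith)]
    refine lintegral_congr fun x => ?_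
    rw [← ofReal_norm, ENNReal.ofReal_rpow_of_nonneg (norm_nonneg _) (by linarith)]
  have hbint : ∫⁻ t in Ioi 0, b t * ENNReal.ofReal (t ^ (p - 1)) =
      C₂ * (ENNReal.ofReal (γ ^ (-p) / (p - 2)) * ∫⁻ x, ‖f x‖ₑ ^ p ∂μ) := by
    have h1 := lintegral_rpow_eq_layercake (μ := μ) hp hf hγ0
    simp only [hb, mul_assoc (C₂ : ℝ≥0∞)]
    rw [lintegral_const_mul' _ _ ENNReal.coe_ne_top]
    congr 1
    have hp2 : ENNReal.ofReal (p - 2) ≠ 0 := by simpa using hp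
    rw [← ENNReal.mul_right_inj hp2 ENNReal.ofReal_ne_top, h1, ← mul_assoc,
      ← ENNReal.ofReal_mul (by linarith)]
    congr 2
    have : p - 2 ≠ 0 := by linarith
    field_simp
  calc ∫⁻ x, ‖g x‖ₑ ^ p ∂μ
      ≤ ENNReal.ofReal p * ∫⁻ t in Ioi 0, e t * ENNReal.ofReal (t ^ (p - 1)) := by
        rw [hlayer]
        refine mul_le_mul' le_rfl (setLIntegral_mono' measurableSet_Ioi fun t ht => ?_)
        refine mul_le_mul' ((measure_mono fun x hx => ?_).trans
          (hG.measure_lt_enorm_le hshrink hg (ENNReal.ofReal t))) le_rfl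
        change ENNReal.ofReal t < ‖g x‖ₑ
        rw [← ofReal_norm]
        exact (ENNReal.ofReal_lt_ofReal_iff_of_nonneg (le_of_lt ht)).2 hx
    _ ≤ ENNReal.ofReal p * (2 * (ENNReal.ofReal (2 ^ p) *
          (C₂ * (ENNReal.ofReal (γ ^ (-p) / (p - 2)) * ∫⁻ x, ‖f x‖ₑ ^ p ∂μ)))) := by
        rw [← hbint]
        gcongr
    _ = _ := by
        change _ = ENNReal.ofReal (p * (2 * (2 ^ p * (C₂ * (γ ^ (-p) / (p - 2)))))) * _
        rw [ENNReal.ofReal_mul (by linarith), ENNReal.ofReal_mul (by linarith),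
          ENNReal.ofReal_mul (by positivity), ENNReal.ofReal_mul (by positivity),
          ENNReal.ofReal_coe_nnreal, ENNReal.ofReal_ofNat]
        ring

end Grid

/-! ### Mean oscillation -/

section Oscillation

variable {X 𝕜 : Type*} [MeasurableSpace X] {μ : Measure X} [RCLike 𝕜]

/-- A bound for the differences `g z - g w` on a set gives a bound for the mean oscillation. -/
lemma lintegral_enorm_sub_setAverage_le {g : X → 𝕜} {u : X → ℝ≥0∞} {Q : Set X} {B : ℝ≥0∞}
    (hQ0 : μ Q ≠ 0) (hQ : μ Q ≠ ∞) (hg : IntegrableOn g Q μ)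
    (h : ∀ᵐ z ∂μ.restrict Q, ∀ᵐ w ∂μ.restrict Q, ‖g z - g w‖ₑ ≤ u z + u w + B) :
    ∫⁻ z in Q, ‖g z - ⨍ w in Q, g w ∂μ‖ₑ ∂μ ≤ B * μ Q + 2 * ∫⁻ z in Q, u z ∂μ := by
  -- the normalized measure on `Q`, for which `g z - g_Q` is the integral of `g z - g w` in `w`
  set ν : Measure X := (μ Q)⁻¹ • μ.restrict Q with hν
  have hprob : IsProbabilityMeasure ν := ⟨by simp [hν, ENNReal.inv_mul_cancel hQ0 hQ]⟩
  have hgν : Integrable g ν := hg.smul_measure (ENNReal.inv_ne_top.2 hQ0)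
  have havg : ⨍ w in Q, g w ∂μ = ∫ w, g w ∂ν := by
    rw [average, Measure.restrict_apply_univ]
  have hpt : ∀ᵐ z ∂μ.restrict Q,
      ‖g z - ⨍ w in Q, g w ∂μ‖ₑ ≤ u z + (∫⁻ w, u w ∂ν + B) := by
    filter_upwards [h] with z hz
    have h1 : g z - ⨍ w in Q, g w ∂μ = ∫ w, (g z - g w) ∂ν := by
      rw [havg, integral_sub (integrable_const _) hgν]
      simp
    have hz' : ∀ᵐ w ∂ν, ‖g z - g w‖ₑ ≤ u z + u w + B := Measure.ae_smul_measure hz _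
    calc ‖g z - ⨍ w in Q, g w ∂μ‖ₑ ≤ ∫⁻ w, ‖g z - g w‖ₑ ∂ν := by
          rw [h1]
          exact enorm_integral_le_lintegral_enorm _
      _ ≤ ∫⁻ w, (u z + u w + B) ∂ν := lintegral_mono_ae hz'
      _ = _ := by
          rw [lintegral_add_right _ measurable_const, lintegral_add_left measurable_const]
          simp [add_assoc]
  calc ∫⁻ z in Q, ‖g z - ⨍ w in Q, g w ∂μ‖ₑ ∂μ
      ≤ ∫⁻ z in Q, (u z + (∫⁻ w, u w ∂ν + B)) ∂μ := lintegral_mono_ae hpt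
    _ = ∫⁻ z in Q, u z ∂μ + (∫⁻ w, u w ∂ν + B) * μ Q := by
        rw [lintegral_add_right _ measurable_const, setLIntegral_const]
    _ = _ := by
        rw [hν, lintegral_smul_measure, smul_eq_mul, add_mul, mul_right_comm,
          ENNReal.inv_mul_cancel hQ0 hQ]
        ring

end Oscillation

/-! ### Truncated integrals and their limit -/

section Operator

variable {𝕜 : Type*} [RCLike 𝕜] {d : ℕ} {U : Set (Eucl d)} {K : ℝ → ℝ → Eucl d → Eucl d → 𝕜}

lemma cylMeasure_restrict {s : Set (ℝ × Eucl d)} (hs : s ⊆ Ioi (0 : ℝ) ×ˢ U) :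
    (cylMeasure U).restrict s = volume.restrict s := by
  rw [cylMeasure, Measure.restrict_restrict_of_subset hs]

lemma Ioo_prod_subset (a : ℝ) : Ioo 0 a ×ˢ U ⊆ Ioi (0 : ℝ) ×ˢ U :=
  prod_mono Ioo_subset_Ioi_self le_rfl

lemma ae_mem_cyl (hU : MeasurableSet U) : ∀ᵐ z ∂(cylMeasure U), z ∈ Ioi (0 : ℝ) ×ˢ U :=
  ae_restrict_mem (measurableSet_Ioi.prod hU)

lemma truncOp_congr {f f' : ℝ × Eucl d → 𝕜} (h : f =ᵐ[cylMeasure U] f') (ε : ℝ) :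
    truncOp U K ε f = truncOp U K ε f' := by
  funext z
  refine integral_congr_ae ?_
  rw [← cylMeasure_restrict (Ioo_prod_subset _)]
  filter_upwards [ae_restrict_of_ae h] with w hw
  rw [hw]

lemma aestronglyMeasurable_truncOp (hK : IsVolterraKernel U K)
    {f : ℝ × Eucl d → 𝕜} (hf : AEStronglyMeasurable f (cylMeasure U)) (ε : ℝ) :
    AEStronglyMeasurable (truncOp U K ε f) (cylMeasure U) := by
  set S : Set ((ℝ × Eucl d) × (ℝ × Eucl d)) := {q | q.1.1 < q.2.1 - ε} with hS
  have hSm : MeasurableSet S :=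
    measurableSet_lt (by fun_prop) (by fun_prop)
  have h1 : AEStronglyMeasurable (S.indicator fun q : (ℝ × Eucl d) × (ℝ × Eucl d) =>
      K q.1.1 q.2.1 q.1.2 q.2.2 * f q.1) ((cylMeasure U).prod (cylMeasure U)) :=
    (hK.measurable.mul hf.comp_fst).indicator hSm
  have : SFinite (cylMeasure U) := by unfold cylMeasure; infer_instance
  have h2 := h1.prod_swap.integral_prod_right'
  refine h2.congr (Eventually.of_forall fun z => ?_)
  have h3 : ∀ w : ℝ × Eucl d, S.indicator (fun q : (ℝ × Eucl d) × (ℝ × Eucl d) =>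
      K q.1.1 q.2.1 q.1.2 q.2.2 * f q.1) (w, z) =
      ({w : ℝ × Eucl d | w.1 < z.1 - ε}).indicator
        (fun w => K w.1 z.1 w.2 z.2 * f w) w := by
    intro w
    simp [indicator, hS]
  simp only [Prod.swap_prod_mk, h3]
  rw [integral_indicator (measurableSet_lt (by fun_prop) (by fun_prop)), cylMeasure,
    Measure.restrict_restrict (measurableSet_lt (by fun_prop) (by fun_prop)), truncOp]
  congr 2
  ext w
  simp only [mem_inter_iff, mem_prod, mem_Ioi, mem_Ioo]
  exact ⟨fun h => ⟨⟨h.2.1, h.1⟩, h.2.2⟩, fun h => ⟨h.1.2, h.1.1, h.2⟩⟩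

/-- `T` is additive, up to null sets: the chosen limits are unique almost everywhere. -/
lemma volterraOp_add_ae (hK : IsVolterraKernel U K) (hT : IsL2Bounded U K)
    {f f₁ f₂ : ℝ × Eucl d → 𝕜} (h₁ : MemLp f₁ 2 (cylMeasure U)) (h₂ : MemLp f₂ 2 (cylMeasure U))
    (hf : f =ᵐ[cylMeasure U] f₁ + f₂) :
    volterraOp U K f =ᵐ[cylMeasure U] volterraOp U K f₁ + volterraOp U K f₂ := by
  set μ := cylMeasure U
  have hfL : MemLp f 2 μ := (h₁.add h₂).ae_eq hf.symm
  obtain ⟨hg, hlim⟩ := hT.tendsto f hfL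
  obtain ⟨hg₁, hlim₁⟩ := hT.tendsto f₁ h₁
  obtain ⟨hg₂, hlim₂⟩ := hT.tendsto f₂ h₂
  set g := volterraOp U K f
  set g₁ := volterraOp U K f₁
  set g₂ := volterraOp U K f₂
  have hbound : ∀ᶠ ε in 𝓝[>] (0 : ℝ), eLpNorm (g - (g₁ + g₂)) 2 μ ≤
      eLpNorm (truncOp U K ε f - g) 2 μ + (eLpNorm (truncOp U K ε f₁ - g₁) 2 μ +
        eLpNorm (truncOp U K ε f₂ - g₂) 2 μ) := by
    filter_upwards [self_mem_nhdsWithin] with ε hε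
    have hadd : truncOp U K ε f =ᵐ[μ] truncOp U K ε f₁ + truncOp U K ε f₂ := by
      rw [truncOp_congr hf]
      filter_upwards [hT.integrable f₁ h₁ ε hε, hT.integrable f₂ h₂ ε hε] with z hz₁ hz₂
      simp only [truncOp, Pi.add_apply, mul_add]
      exact integral_add hz₁ hz₂
    have hm := aestronglyMeasurable_truncOp hK hfL.1 ε
    have hm₁ := aestronglyMeasurable_truncOp hK h₁.1 ε
    have hm₂ := aestronglyMeasurable_truncOp hK h₂.1 ε
    have heq : g - (g₁ + g₂) =ᵐ[μ] -(truncOp U K ε f - g) +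
        ((truncOp U K ε f₁ - g₁) + (truncOp U K ε f₂ - g₂)) := by
      filter_upwards [hadd] with z hz
      simp only [Pi.add_apply, Pi.sub_apply, Pi.neg_apply, hz]
      ring
    rw [eLpNorm_congr_ae heq, ← eLpNorm_neg (truncOp U K ε f - g)]
    refine (eLpNorm_add_le (hm.sub hg.1).neg ((hm₁.sub hg₁.1).add (hm₂.sub hg₂.1))
      (by norm_num)).trans ?_
    gcongr
    exact eLpNorm_add_le (hm₁.sub hg₁.1) (hm₂.sub hg₂.1) (by norm_num)
  have h0 : eLpNorm (g - (g₁ + g₂)) 2 μ ≤ 0 := by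
    have := ge_of_tendsto (hlim.add (hlim₁.add hlim₂)) hbound
    simpa using this
  have h1 := (eLpNorm_eq_zero_iff (hg.1.sub (hg₁.1.add hg₂.1)) (by norm_num)).1
    (le_antisymm h0 bot_le)
  filter_upwards [h1] with z hz
  exact sub_eq_zero.1 hz

lemma exists_seq_truncOp_tendsto_ae (hK : IsVolterraKernel U K) (hT : IsL2Bounded U K)
    {f : ℝ × Eucl d → 𝕜} (hf : MemLp f 2 (cylMeasure U)) :
    ∃ ε : ℕ → ℝ, Tendsto ε atTop (𝓝[>] 0) ∧ ∀ᵐ z ∂(cylMeasure U),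
      Tendsto (fun n => truncOp U K (ε n) f z) atTop (𝓝 (volterraOp U K f z)) := by
  obtain ⟨hg, hlim⟩ := hT.tendsto f hf
  exact (tendstoInMeasure_of_tendsto_eLpNorm two_ne_zero
    (aestronglyMeasurable_truncOp hK hf.1) hg.1 hlim).exists_seq_tendsto_ae'

lemma IsL2Bounded.ae_integrableOn (hT : IsL2Bounded U K) {f : ℝ × Eucl d → 𝕜}
    (hf : MemLp f 2 (cylMeasure U)) :
    ∀ᵐ z ∂(cylMeasure U), ∀ ε : ℝ, 0 < ε →
      IntegrableOn (fun w : ℝ × Eucl d => K w.1 z.1 w.2 z.2 * f w) (Ioo 0 (z.1 - ε) ×ˢ U) := by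
  have h := ae_all_iff.2 fun n : ℕ => hT.integrable f hf (1 / ((n : ℝ) + 1)) (by positivity)
  filter_upwards [h] with z hz ε hε
  obtain ⟨n, hn⟩ := exists_nat_one_div_lt hε
  exact (hz n).mono_set (prod_mono (Ioo_subset_Ioo_right (by linarith)) le_rfl)

lemma tendsto_setIntegral_Ioo_prod (hU : MeasurableSet U) {h : ℝ × Eucl d → 𝕜} {s : ℝ}
    (hh : IntegrableOn h (Ioo 0 s ×ˢ U)) {ε : ℕ → ℝ} (hε : Tendsto ε atTop (𝓝[>] 0)) :
    Tendsto (fun n => ∫ w in Ioo 0 (s - ε n) ×ˢ U, h w) atTop (𝓝 (∫ w in Ioo 0 s ×ˢ U, h w)) := by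
  have hm : ∀ a : ℝ, MeasurableSet (Ioo 0 a ×ˢ U) := fun a => measurableSet_Ioo.prod hU
  simp only [← integral_indicator (hm _)]
  have hpos : ∀ᶠ n in atTop, 0 < ε n := hε.eventually self_mem_nhdsWithin
  have hsub : ∀ᶠ n in atTop, Ioo 0 (s - ε n) ×ˢ U ⊆ Ioo 0 s ×ˢ U := by
    filter_upwards [hpos] with n hn
    exact prod_mono (Ioo_subset_Ioo_right (by linarith)) le_rfl
  refine tendsto_integral_filter_of_dominated_convergence
    (fun w => ‖(Ioo 0 s ×ˢ U).indicator h w‖) ?_ ?_ (hh.integrable_indicator (hm _)).norm ?_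
  · filter_upwards [hsub] with n hn
    exact ((hh.mono_set hn).integrable_indicator (hm _)).1
  · filter_upwards [hsub] with n hn
    exact Eventually.of_forall fun w => norm_indicator_le_of_subset hn _ _
  · refine Eventually.of_forall fun w => ?_
    have h0 : Tendsto ε atTop (𝓝 0) := hε.mono_right nhdsWithin_le_nhds
    refine tendsto_const_nhds.congr' ?_
    by_cases hw : w ∈ Ioo 0 s ×ˢ U
    · have hlt : ∀ᶠ n in atTop, ε n < s - w.1 :=
        h0.eventually (gt_mem_nhds (by linarith [hw.1.2]))
      filter_upwards [hlt] with n hn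
      rw [indicator_of_mem hw, indicator_of_mem]
      exact ⟨⟨hw.1.1, by linarith⟩, hw.2⟩
    · filter_upwards [hsub] with n hn
      rw [indicator_of_notMem hw, indicator_of_notMem (fun h => hw (hn h))]

/-- Differences of the limits of the truncated integrals at two points are controlled by the
difference of the kernels: with `s < t` the times of the two points, the truncated integrals
combine, up to an integral over times in `(s - ε, s)` that vanishes in the limit, to an integral
of the difference of the kernels, because `K(r, s, ·, ·) = 0` for `r ≥ s`. -/
lemma enorm_sub_le_of_tendsto_truncOp (hU : MeasurableSet U) (hK : IsVolterraKernel U K)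
    {f : ℝ × Eucl d → 𝕜} {z w : ℝ × Eucl d} (hw : w ∈ Ioi (0 : ℝ) ×ˢ U) (hlt : w.1 < z.1)
    (hzi : ∀ ε : ℝ, 0 < ε →
      IntegrableOn (fun q : ℝ × Eucl d => K q.1 z.1 q.2 z.2 * f q) (Ioo 0 (z.1 - ε) ×ˢ U))
    (hwi : ∀ ε : ℝ, 0 < ε →
      IntegrableOn (fun q : ℝ × Eucl d => K q.1 w.1 q.2 w.2 * f q) (Ioo 0 (w.1 - ε) ×ˢ U))
    {ε : ℕ → ℝ} (hε : Tendsto ε atTop (𝓝[>] 0)) {a b : 𝕜}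
    (ha : Tendsto (fun n => truncOp U K (ε n) f z) atTop (𝓝 a))
    (hb : Tendsto (fun n => truncOp U K (ε n) f w) atTop (𝓝 b)) {B : ℝ≥0∞}
    (hB : ∫⁻ q in Ioi (0 : ℝ) ×ˢ U, ‖K q.1 z.1 q.2 z.2 - K q.1 w.1 q.2 w.2‖ₑ * ‖f q‖ₑ ≤ B) :
    ‖a - b‖ₑ ≤ B := by
  set F : ℝ × Eucl d → 𝕜 := fun q => K q.1 z.1 q.2 z.2 * f q with hF
  set G : ℝ × Eucl d → 𝕜 := fun q => K q.1 w.1 q.2 w.2 * f q with hG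
  have hm : ∀ a : ℝ, MeasurableSet (Ioo 0 a ×ˢ U) := fun a => measurableSet_Ioo.prod hU
  have hFs : IntegrableOn F (Ioo 0 w.1 ×ˢ U) := by
    have := hzi (z.1 - w.1) (by linarith)
    rwa [sub_sub_cancel] at this
  -- with `s = w.1`, the integral of `F` over times in `[s - ε, s)` tends to zero
  have hR := (tendsto_const_nhds (x := ∫ q in Ioo 0 w.1 ×ˢ U, F q)).sub
    (tendsto_setIntegral_Ioo_prod hU hFs hε)
  rw [sub_self] at hR
  have hlim := ((ha.sub hb).sub hR).enorm
  rw [sub_zero] at hlim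
  refine le_of_tendsto hlim ?_
  have hpos : ∀ᶠ n in atTop, 0 < ε n := hε.eventually self_mem_nhdsWithin
  have hsmall : ∀ᶠ n in atTop, ε n < z.1 - w.1 :=
    (hε.mono_right nhdsWithin_le_nhds).eventually (gt_mem_nhds (by linarith))
  filter_upwards [hpos, hsmall] with n hn hn'
  set e := ε n
  have hC : MeasurableSet (Ico w.1 (z.1 - e) ×ˢ U) := measurableSet_Ico.prod hU
  have hunion : Ioo 0 (z.1 - e) ×ˢ U = Ioo 0 w.1 ×ˢ U ∪ Ico w.1 (z.1 - e) ×ˢ U := by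
    rw [← union_prod, Ioo_union_Ico_eq_Ioo hw.1 (by linarith)]
  have hdisj : Disjoint (Ioo 0 w.1 ×ˢ U) (Ico w.1 (z.1 - e) ×ˢ U) :=
    Disjoint.set_prod_left (Set.disjoint_left.2 fun x hx hx' => hx.2.not_ge hx'.1) _ _
  have hdisj' : Disjoint (Ioo 0 (w.1 - e) ×ˢ U) (Ico w.1 (z.1 - e) ×ˢ U) :=
    hdisj.mono_left (prod_mono (Ioo_subset_Ioo_right (by linarith)) le_rfl)
  have hz1 : truncOp U K e f z =
      (∫ q in Ioo 0 w.1 ×ˢ U, F q) + ∫ q in Ico w.1 (z.1 - e) ×ˢ U, F q := by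
    have hint := hzi e hn
    rw [hunion] at hint
    rw [truncOp, hunion, setIntegral_union hdisj hC hint.left_of_union hint.right_of_union]
  have hw1 : truncOp U K e f w = ∫ q in Ioo 0 (w.1 - e) ×ˢ U, G q := rfl
  have hFw : IntegrableOn F (Ioo 0 (w.1 - e) ×ˢ U) :=
    hFs.mono_set (prod_mono (Ioo_subset_Ioo_right (by linarith)) le_rfl)
  have heq : truncOp U K e f z - truncOp U K e f w -
      ((∫ q in Ioo 0 w.1 ×ˢ U, F q) - ∫ q in Ioo 0 (w.1 - e) ×ˢ U, F q) =
      (∫ q in Ioo 0 (w.1 - e) ×ˢ U, (F q - G q)) + ∫ q in Ico w.1 (z.1 - e) ×ˢ U, F q := by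
    rw [integral_sub hFw (hwi e hn), hz1, hw1]
    ring
  have hFG : ∀ q, ‖F q - G q‖ₑ = ‖K q.1 z.1 q.2 z.2 - K q.1 w.1 q.2 w.2‖ₑ * ‖f q‖ₑ := by
    intro q
    rw [hF, hG, ← sub_mul, enorm_mul]
  have hCeq : ∫⁻ q in Ico w.1 (z.1 - e) ×ˢ U, ‖F q‖ₑ =
      ∫⁻ q in Ico w.1 (z.1 - e) ×ˢ U, ‖F q - G q‖ₑ := by
    refine setLIntegral_congr_fun hC fun q hq => ?_
    have h0 : K q.1 w.1 q.2 w.2 = 0 :=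
      hK.eq_zero q.1 w.1 (lt_of_lt_of_le hw.1 hq.1.1) hw.1 hq.1.1 _ hq.2 _ hw.2
    simp [hG, h0]
  calc ‖truncOp U K e f z - truncOp U K e f w -
      ((∫ q in Ioo 0 w.1 ×ˢ U, F q) - ∫ q in Ioo 0 (w.1 - e) ×ˢ U, F q)‖ₑ
      ≤ (∫⁻ q in Ioo 0 (w.1 - e) ×ˢ U, ‖F q - G q‖ₑ) +
          ∫⁻ q in Ico w.1 (z.1 - e) ×ˢ U, ‖F q‖ₑ := by
        rw [heq]
        exact (enorm_add_le _ _).trans (add_le_add (enorm_integral_le_lintegral_enorm _)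
          (enorm_integral_le_lintegral_enorm _))
    _ = ∫⁻ q in Ioo 0 (w.1 - e) ×ˢ U ∪ Ico w.1 (z.1 - e) ×ˢ U, ‖F q - G q‖ₑ := by
        rw [hCeq, lintegral_union hC hdisj']
    _ ≤ ∫⁻ q in Ioi (0 : ℝ) ×ˢ U, ‖F q - G q‖ₑ := by
        refine lintegral_mono_set (union_subset (Ioo_prod_subset _) ?_)
        exact prod_mono (fun x hx => lt_of_lt_of_le hw.1 hx.1) le_rfl
    _ ≤ B := by
        simp only [hFG]
        exact hB

end Operator

/-! ### Mean oscillation of the operator over a set -/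

section Operator

variable {𝕜 : Type*} [RCLike 𝕜] {d : ℕ} {U : Set (Eucl d)} {K : ℝ → ℝ → Eucl d → Eucl d → 𝕜}

lemma ae_fst_ne (t : ℝ) : ∀ᵐ w : ℝ × Eucl d, w.1 ≠ t := by
  have : (volume : Measure (ℝ × Eucl d)) (({t} : Set ℝ) ×ˢ univ) = 0 := by
    rw [Measure.volume_eq_prod, Measure.prod_prod]
    simp
  refine measure_mono_null (fun w hw => ?_) this
  simpa using hw

/-- If `f` is bounded by `M` and vanishes on `Q'`, and the kernels at any two points of `Q` at
different times differ by at most `N₆` in `L_1` off `Q'`, then `T f` varies by at most `N₆ M`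
on `Q`. -/
lemma ae_enorm_volterraOp_sub_le (hU : MeasurableSet U) (hK : IsVolterraKernel U K)
    (hT : IsL2Bounded U K) {f : ℝ × Eucl d → 𝕜} (hf : MemLp f 2 (cylMeasure U)) {M : ℝ≥0}
    (hM : ∀ᵐ z ∂(cylMeasure U), ‖f z‖ₑ ≤ M) {Q Q' : Set (ℝ × Eucl d)} (hQ' : MeasurableSet Q')
    (hf0 : ∀ z ∈ Q', f z = 0) {N₆ : ℝ≥0}
    (hpair : ∀ z ∈ Q, ∀ w ∈ Q, z.1 ≠ w.1 →
      ∫⁻ q in Q'ᶜ, ‖K q.1 z.1 q.2 z.2 - K q.1 w.1 q.2 w.2‖ₑ ∂(cylMeasure U) ≤ N₆) :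
    ∀ᵐ z ∂(cylMeasure U), ∀ᵐ w ∂(cylMeasure U), z ∈ Q → w ∈ Q →
      ‖volterraOp U K f z - volterraOp U K f w‖ₑ ≤ N₆ * M := by
  set μ := cylMeasure U with hμ
  have hbound : ∀ z ∈ Q, ∀ w ∈ Q, z.1 ≠ w.1 →
      ∫⁻ q in Ioi (0 : ℝ) ×ˢ U, ‖K q.1 z.1 q.2 z.2 - K q.1 w.1 q.2 w.2‖ₑ * ‖f q‖ₑ ≤ N₆ * M := by
    intro z hz w hw hzw
    calc _ ≤ ∫⁻ q, Q'ᶜ.indicator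
          (fun q => ‖K q.1 z.1 q.2 z.2 - K q.1 w.1 q.2 w.2‖ₑ * M) q ∂μ := by
          refine lintegral_mono_ae ?_
          filter_upwards [hM] with q hq
          by_cases hqQ : q ∈ Q'
          · simp [hf0 q hqQ]
          · rw [indicator_of_mem (by exact hqQ)]
            gcongr
      _ = (∫⁻ q in Q'ᶜ, ‖K q.1 z.1 q.2 z.2 - K q.1 w.1 q.2 w.2‖ₑ ∂μ) * M := by
          rw [lintegral_indicator hQ'.compl, lintegral_mul_const' _ _ ENNReal.coe_ne_top]
      _ ≤ N₆ * M := by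
          gcongr
          exact hpair z hz w hw hzw
  obtain ⟨ε, hε, hlim⟩ := exists_seq_truncOp_tendsto_ae hK hT hf
  have hgood := (ae_mem_cyl hU).and ((hT.ae_integrableOn hf).and hlim)
  filter_upwards [hgood] with z ⟨hzΩ, hzi, hzl⟩
  filter_upwards [hgood, ae_restrict_of_ae (ae_fst_ne z.1)] with w ⟨hwΩ, hwi, hwl⟩ hne hz hw
  rcases lt_or_gt_of_ne hne with h | h
  · exact enorm_sub_le_of_tendsto_truncOp hU hK hwΩ h hzi hwi hε hzl hwl
      (hbound z hz w hw hne.symm)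
  · rw [← enorm_neg, neg_sub]
    exact enorm_sub_le_of_tendsto_truncOp hU hK hzΩ h hwi hzi hε hwl hzl
      (hbound w hw z hz hne)

lemma sq_setLIntegral_enorm_le {X F : Type*} [MeasurableSpace X] [NormedAddCommGroup F]
    {μ : Measure X} {f : X → F} (hf : AEStronglyMeasurable f μ) (s : Set X) :
    (∫⁻ x in s, ‖f x‖ₑ ∂μ) ^ 2 ≤ μ s * eLpNorm f 2 μ ^ 2 := by
  refine (sq_lintegral_le _ hf.enorm.restrict).trans ?_
  rw [Measure.restrict_apply_univ, sq_eLpNorm_two]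
  gcongr
  exact Measure.restrict_le_self

/-- The mean oscillation of `T (f' + f'')` over `Q`, for bounded `f''`: the part of `f''` on `Q'`
is estimated in `L_2`, the part off `Q'` by the differences of the kernels. -/
lemma lintegral_oscillation_volterraOp_le (hU : MeasurableSet U) (hK : IsVolterraKernel U K)
    (hT : IsL2Bounded U K) {N₅ N₆ A M : ℝ≥0}
    (hN₅ : ∀ f : ℝ × Eucl d → 𝕜, MemLp f 2 (cylMeasure U) →
      eLpNorm (volterraOp U K f) 2 (cylMeasure U) ≤ N₅ * eLpNorm f 2 (cylMeasure U))
    {Q Q' : Set (ℝ × Eucl d)} (hQm : MeasurableSet Q) (hQ' : MeasurableSet Q')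
    (hQ0 : cylMeasure U Q ≠ 0) (hQtop : cylMeasure U Q ≠ ∞)
    (hA : cylMeasure U Q' ≤ A ^ 2 * cylMeasure U Q)
    (hpair : ∀ z ∈ Q, ∀ w ∈ Q, z.1 ≠ w.1 →
      ∫⁻ q in Q'ᶜ, ‖K q.1 z.1 q.2 z.2 - K q.1 w.1 q.2 w.2‖ₑ ∂(cylMeasure U) ≤ N₆)
    {f f' f'' : ℝ × Eucl d → 𝕜} (hf' : MemLp f' 2 (cylMeasure U))
    (hf'' : MemLp f'' 2 (cylMeasure U)) (hf : f =ᵐ[cylMeasure U] f' + f'')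
    (hM : ∀ᵐ z ∂(cylMeasure U), ‖f'' z‖ₑ ≤ M) :
    ∫⁻ z in Q, ‖volterraOp U K f z -
        ⨍ w in Q, volterraOp U K f w ∂(cylMeasure U)‖ₑ ∂(cylMeasure U) ≤
      (2 * N₅ * A + N₆) * M * cylMeasure U Q +
        2 * ∫⁻ z in Q, ‖volterraOp U K f' z‖ₑ ∂(cylMeasure U) := by
  set μ := cylMeasure U with hμ
  -- `f''` is split into its parts on and off `Q'`
  set f₁ := Q'.indicator f'' with hf₁
  set f₂ := Q'ᶜ.indicator f'' with hf₂
  have h₁ : MemLp f₁ 2 μ := hf''.indicator hQ'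
  have h₂ : MemLp f₂ 2 μ := hf''.indicator hQ'.compl
  have hM₂ : ∀ᵐ z ∂μ, ‖f₂ z‖ₑ ≤ M := by
    filter_upwards [hM] with z hz
    exact (enorm_indicator_le_enorm_self _ _).trans hz
  have hadd := volterraOp_add_ae hK hT hf' hf'' hf
  have hadd' := volterraOp_add_ae hK hT h₁ h₂
    (EventuallyEq.of_eq (indicator_self_add_compl Q' f'').symm)
  have hpt := ae_enorm_volterraOp_sub_le (Q := Q) hU hK hT h₂ hM₂ hQ'
    (fun z hz => by simp [hf₂, hz]) hpair
  have hfL : MemLp f 2 μ := (hf'.add hf'').ae_eq hf.symm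
  set g := volterraOp U K f
  set g' := volterraOp U K f'
  set g'' := volterraOp U K f''
  set g₁ := volterraOp U K f₁
  set g₂ := volterraOp U K f₂
  have hg' : MemLp g' 2 μ := (hT.tendsto f' hf').1
  have hg₁ : MemLp g₁ 2 μ := (hT.tendsto f₁ h₁).1
  have hgint : IntegrableOn g Q μ := by
    have : IsFiniteMeasure (μ.restrict Q) := isFiniteMeasure_restrict.2 hQtop
    exact ((hT.tendsto f hfL).1.restrict Q).integrable (by norm_num)
  have hdiff : ∀ᵐ z ∂μ.restrict Q, ∀ᵐ w ∂μ.restrict Q,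
      ‖g z - g w‖ₑ ≤ (‖g' z‖ₑ + ‖g₁ z‖ₑ) + (‖g' w‖ₑ + ‖g₁ w‖ₑ) + N₆ * M := by
    have hae := (hadd.and hadd').filter_mono (ae_mono (Measure.restrict_le_self (s := Q)))
    filter_upwards [hae, ae_restrict_of_ae hpt, ae_restrict_mem hQm] with z ⟨hz, hz'⟩ hzp hzQ
    filter_upwards [hae, ae_restrict_of_ae hzp, ae_restrict_mem hQm] with w ⟨hw, hw'⟩ hwp hwQ
    have e : g z - g w = (g' z + g₁ z) - (g' w + g₁ w) + (g₂ z - g₂ w) := by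
      rw [hz, hw, Pi.add_apply, Pi.add_apply, hz', hw', Pi.add_apply, Pi.add_apply]
      ring
    rw [e]
    refine (enorm_add_le _ _).trans (add_le_add ?_ (hwp hzQ hwQ))
    exact enorm_sub_le.trans (add_le_add (enorm_add_le _ _) (enorm_add_le _ _))
  refine (lintegral_enorm_sub_setAverage_le (u := fun z => ‖g' z‖ₑ + ‖g₁ z‖ₑ) hQ0 hQtop hgint
    hdiff).trans ?_
  have hg₁Q : ∫⁻ z in Q, ‖g₁ z‖ₑ ∂μ ≤ N₅ * A * M * μ Q := by
    have hf₁norm : eLpNorm f₁ 2 μ ^ 2 ≤ (M * A) ^ 2 * μ Q := by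
      rw [sq_eLpNorm_two]
      calc ∫⁻ z, ‖f₁ z‖ₑ ^ 2 ∂μ ≤ ∫⁻ z, Q'.indicator (fun _ => (M : ℝ≥0∞) ^ 2) z ∂μ := by
            refine lintegral_mono_ae ?_
            filter_upwards [hM] with z hz
            by_cases hzQ : z ∈ Q'
            · simp only [hf₁, indicator_of_mem hzQ]
              gcongr
            · simp [hf₁, indicator_of_notMem hzQ]
        _ = M ^ 2 * μ Q' := by rw [lintegral_indicator hQ', setLIntegral_const]
        _ ≤ M ^ 2 * (A ^ 2 * μ Q) := by gcongr
        _ = _ := by ring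
    have hsq : (∫⁻ z in Q, ‖g₁ z‖ₑ ∂μ) ^ 2 ≤ (N₅ * A * M * μ Q) ^ 2 := by
      calc _ ≤ μ Q * eLpNorm g₁ 2 μ ^ 2 := sq_setLIntegral_enorm_le hg₁.1 Q
        _ ≤ μ Q * (N₅ * eLpNorm f₁ 2 μ) ^ 2 := by
            gcongr
            exact hN₅ f₁ h₁
        _ = μ Q * (N₅ ^ 2 * eLpNorm f₁ 2 μ ^ 2) := by ring
        _ ≤ μ Q * (N₅ ^ 2 * ((M * A) ^ 2 * μ Q)) := by gcongr
        _ = _ := by ring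
    exact (ENNReal.pow_le_pow_left_iff two_ne_zero).1 hsq
  rw [lintegral_add_right' _ hg₁.1.enorm.restrict, mul_add]
  calc N₆ * M * μ Q + (2 * ∫⁻ z in Q, ‖g' z‖ₑ ∂μ + 2 * ∫⁻ z in Q, ‖g₁ z‖ₑ ∂μ)
      ≤ N₆ * M * μ Q + (2 * ∫⁻ z in Q, ‖g' z‖ₑ ∂μ + 2 * (N₅ * A * M * μ Q)) := by gcongr
    _ = _ := by ring

end Operator

/-! ### Enlarged cylinders and their measures -/

lemma IsScaling.exists_dilation_bound {φ : ℝ → ℝ} (hφ : IsScaling φ) (a : ℝ) (ha : 0 < a) :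
    ∃ C : ℝ, 0 < C ∧ ∀ r, 0 < r → φ (a * r) ≤ C * φ r := by
  obtain ⟨C, hC⟩ := hφ.doubling
  have hC0 : 0 ≤ C := (div_nonneg (hφ.pos _ (by norm_num)).le (hφ.pos 1 one_pos).le).trans
    (hC 1 one_pos)
  have hpow : ∀ k : ℕ, ∀ r, 0 < r → φ (2 ^ k * r) ≤ C ^ k * φ r := by
    intro k
    induction k with
    | zero => intro r _; simp
    | succ k ih =>
      intro r hr
      have hr' : 0 < 2 ^ k * r := by positivity
      have h := hC _ hr'
      rw [div_le_iff₀ (hφ.pos _ hr')] at h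
      calc φ (2 ^ (k + 1) * r) = φ (2 * (2 ^ k * r)) := by congr 1; ring
        _ ≤ C * φ (2 ^ k * r) := h
        _ ≤ C * (C ^ k * φ r) := by gcongr; exact ih r hr
        _ = _ := by ring
  obtain ⟨k, hk⟩ := pow_unbounded_of_one_lt a (one_lt_two (α := ℝ))
  refine ⟨C ^ k + 1, by positivity, fun r hr => ?_⟩
  have hφr := hφ.pos r hr
  calc φ (a * r) ≤ φ (2 ^ k * r) := hφ.mono (show 0 < a * r by positivity)
        (show 0 < 2 ^ k * r by positivity) (by gcongr)
    _ ≤ C ^ k * φ r := hpow k r hr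
    _ ≤ _ := by nlinarith

section Geometry

variable {𝕜 : Type*} [RCLike 𝕜] {d : ℕ} {U : Set (Eucl d)} {K : ℝ → ℝ → Eucl d → Eucl d → 𝕜}
  {φ : ℝ → ℝ}

/-- The Hörmander condition on cylinders: off a fixed enlargement of a cylinder, the kernels at any
two of its points at different times differ by a bounded amount in `L_1`. -/
lemma HormanderCondition.exists_enlargement (hφ : IsScaling φ)
    (hH : HormanderCondition U φ K) :
    ∃ (α β : ℝ) (N₆ : ℝ≥0), 0 < α ∧ 0 < β ∧ ∀ (c t₀ : ℝ) (x₀ : Eucl d), 0 < c →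
      ∀ z ∈ Ioi (0 : ℝ) ×ˢ U, ∀ w ∈ Ioi (0 : ℝ) ×ˢ U,
      z ∈ Ioc t₀ (t₀ + φ c) ×ˢ Metric.ball x₀ c → w ∈ Ioc t₀ (t₀ + φ c) ×ˢ Metric.ball x₀ c →
      z.1 ≠ w.1 →
      ∫⁻ q in (Icc (t₀ - β * φ c) (t₀ + β * φ c) ×ˢ Metric.ball x₀ (α * c))ᶜ,
        ‖K q.1 z.1 q.2 z.2 - K q.1 w.1 q.2 w.2‖ₑ ∂(cylMeasure U) ≤ N₆ := by
  obtain ⟨φ', hpos, ⟨c₁, hc₁, h₁⟩, ⟨c₂, hc₂, h₂⟩, c₀, hc₀, N₆, hN₆⟩ := hH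
  -- `φ'(|t - s|) + |x - y| ≤ (c₂ + 2) c` for points of the cylinder
  set a := c₀ * (c₂ + 2) with ha
  have ha0 : 0 < a := by positivity
  obtain ⟨C, hC0, hC⟩ := hφ.exists_dilation_bound a ha0
  refine ⟨a + 1, c₁ * C + 1, N₆, by positivity, by positivity, ?_⟩
  rintro c t₀ x₀ hc ⟨t, x⟩ ⟨ht, hx⟩ ⟨s, y⟩ ⟨hs, hy⟩ ⟨hzt, hzx⟩ ⟨hws, hwy⟩ hts
  simp only at ht hx hs hy hzt hzx hws hwy hts ⊢
  simp only [mem_Ioc, Metric.mem_ball] at hzt hzx hws hwy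
  refine le_trans ?_ (hN₆ t s ht hs hts x hx y hy)
  rw [cylMeasure, Measure.restrict_restrict
    (measurableSet_Icc.prod Metric.isOpen_ball.measurableSet).compl]
  refine lintegral_mono_set' ?_
  -- `φ'(0)` is meaningless, so the null set of points at time `t` is left out
  filter_upwards [ae_fst_ne t] with q hqt hq
  obtain ⟨hq1, hqΩ⟩ := hq
  refine ⟨hqΩ, ?_⟩
  have hts' : φ' |t - s| ≤ c₂ * c := by
    refine h₂ c hc _ (abs_pos.2 (sub_ne_zero.2 hts)) ?_
    rw [abs_le]
    constructor <;> linarith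
  have hxy : ‖x - y‖ ≤ 2 * c := by
    rw [← dist_eq_norm]
    linarith [dist_triangle_right x y x₀]
  have hle : c₀ * (φ' |t - s| + ‖x - y‖) ≤ a * c := by
    rw [ha, mul_assoc]
    gcongr
    linarith
  refine hle.trans ?_
  have htq : 0 < |t - q.1| := abs_pos.2 (sub_ne_zero.2 (Ne.symm hqt))
  by_cases hqx : q.2 ∈ Metric.ball x₀ ((a + 1) * c)
  · have hqt' : q.1 ∉ Icc (t₀ - (c₁ * C + 1) * φ c) (t₀ + (c₁ * C + 1) * φ c) :=
      fun h => hq1 ⟨h, hqx⟩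
    have hφc := hφ.pos c hc
    have hfar : c₁ * C * φ c < |t - q.1| := by
      by_contra hlt
      have h := abs_le.1 (not_lt.1 hlt)
      refine hqt' ⟨?_, ?_⟩ <;> nlinarith
    have hlow : a * c ≤ φ' |t - q.1| := by
      by_contra hlt
      have h3 : φ (φ' |t - q.1|) ≤ φ (a * c) :=
        hφ.mono (hpos _ htq) (show 0 < a * c by positivity) (not_le.1 hlt).le
      have h4 := h₁ _ htq
      have h5 : c₁ * φ (φ' |t - q.1|) ≤ c₁ * (C * φ c) := by
        gcongr
        exact h3.trans (hC c hc)
      linarith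
    linarith [norm_nonneg (x - q.2)]
  · rw [Metric.mem_ball, not_lt] at hqx
    have h3 : a * c ≤ ‖x - q.2‖ := by
      rw [← dist_eq_norm]
      have := dist_triangle_left q.2 x₀ x
      linarith
    linarith [hpos _ htq]

/-- The Lebesgue measure of the unit ball. -/
noncomputable def ballVol (d : ℕ) : ℝ≥0∞ := volume (Metric.ball (0 : Eucl d) 1)

lemma ballVol_ne_zero (d : ℕ) : ballVol d ≠ 0 :=
  (Metric.measure_ball_pos _ _ one_pos).ne'

lemma ballVol_ne_top (d : ℕ) : ballVol d ≠ ∞ := measure_ball_lt_top.ne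

lemma volume_ball_eq (x : Eucl d) {r : ℝ} (hr : 0 < r) :
    volume (Metric.ball x r) = ENNReal.ofReal (r ^ d) * ballVol d := by
  rw [Measure.addHaar_ball_of_pos _ _ hr, finrank_euclideanSpace_fin, ballVol]

lemma cylMeasure_le_of_subset {s : Set (ℝ × Eucl d)} {I : Set ℝ} {x : Eucl d} {l r : ℝ}
    (hl : 0 ≤ l) (hr : 0 < r) (hI : volume I ≤ ENNReal.ofReal l)
    (hs : s ⊆ I ×ˢ Metric.ball x r) :
    cylMeasure U s ≤ ENNReal.ofReal (l * r ^ d) * ballVol d := by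
  calc cylMeasure U s ≤ volume s := Measure.restrict_le_self s
    _ ≤ volume (I ×ˢ Metric.ball x r) := measure_mono hs
    _ = volume I * (ENNReal.ofReal (r ^ d) * ballVol d) := by
        rw [Measure.volume_eq_prod, Measure.prod_prod, volume_ball_eq x hr]
    _ ≤ ENNReal.ofReal l * (ENNReal.ofReal (r ^ d) * ballVol d) := by gcongr
    _ = _ := by rw [ENNReal.ofReal_mul hl, mul_assoc]

lemma le_cylMeasure_of_subset {s : Set (ℝ × Eucl d)} (hsU : s ⊆ Ioi (0 : ℝ) ×ˢ U) {I : Set ℝ}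
    {x : Eucl d} {l r : ℝ} (hl : 0 ≤ l) (hr : 0 < r) (hI : ENNReal.ofReal l ≤ volume I)
    (hs : I ×ˢ Metric.ball x r ⊆ s) :
    ENNReal.ofReal (l * r ^ d) * ballVol d ≤ cylMeasure U s := by
  calc _ = ENNReal.ofReal l * (ENNReal.ofReal (r ^ d) * ballVol d) := by
        rw [ENNReal.ofReal_mul hl, mul_assoc]
    _ ≤ volume I * (ENNReal.ofReal (r ^ d) * ballVol d) := by gcongr
    _ = volume (I ×ˢ Metric.ball x r) := by
        rw [Measure.volume_eq_prod, Measure.prod_prod, volume_ball_eq x hr]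
    _ ≤ volume s := measure_mono hs
    _ = cylMeasure U s := (Measure.restrict_eq_self _ hsU).symm

/-- The mean oscillation of `T (f' + f'')` over sets that fill at least the fraction `κ` of
a cylinder containing them. With `f' = 0` this is the bound from `L_∞` to `BMO`. -/
theorem exists_oscillation_bound (hU : MeasurableSet U) (hφ : IsScaling φ)
    (hK : IsVolterraKernel U K) (hT : IsL2Bounded U K) (hH : HormanderCondition U φ K) {κ : ℝ}
    (hκ : 0 < κ) :
    ∃ C : ℝ≥0, ∀ (f f' f'' : ℝ × Eucl d → 𝕜) (M : ℝ≥0), MemLp f' 2 (cylMeasure U) →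
      MemLp f'' 2 (cylMeasure U) → f =ᵐ[cylMeasure U] f' + f'' →
      (∀ᵐ z ∂(cylMeasure U), ‖f'' z‖ₑ ≤ M) →
      ∀ (Q : Set (ℝ × Eucl d)) (c t₀ : ℝ) (x₀ : Eucl d), MeasurableSet Q → 0 < c →
        Q ⊆ Ioi (0 : ℝ) ×ˢ U → Q ⊆ Ioc t₀ (t₀ + φ c) ×ˢ Metric.ball x₀ c →
        ENNReal.ofReal (κ * (φ c * c ^ d)) * ballVol d ≤ cylMeasure U Q →
        ∫⁻ z in Q, ‖volterraOp U K f z -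
            ⨍ w in Q, volterraOp U K f w ∂(cylMeasure U)‖ₑ ∂(cylMeasure U) ≤
          C * M * cylMeasure U Q + 2 * ∫⁻ z in Q, ‖volterraOp U K f' z‖ₑ ∂(cylMeasure U) := by
  obtain ⟨α, β, N₆, hα, hβ, hpair⟩ := hH.exists_enlargement hφ
  obtain ⟨N₅, hN₅⟩ := hT.bound
  -- `A²` bounds the ratio of the measures of the enlarged cylinder and of `Q`
  set A : ℝ≥0 := Real.toNNReal (Real.sqrt (2 * β * α ^ d / κ)) with hA
  have hA2 : (A : ℝ≥0∞) ^ 2 = ENNReal.ofReal (2 * β * α ^ d / κ) := by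
    change ENNReal.ofReal _ ^ 2 = _
    rw [← ENNReal.ofReal_pow (Real.sqrt_nonneg _), Real.sq_sqrt (by positivity)]
  refine ⟨2 * N₅ * A + N₆, ?_⟩
  intro f f' f'' M hf' hf'' hf hM Q c t₀ x₀ hQm hc hQΩ hQ hκQ
  have hφc := hφ.pos c hc
  have hQ0 : cylMeasure U Q ≠ 0 := by
    have h1 : ENNReal.ofReal (κ * (φ c * c ^ d)) * ballVol d ≠ 0 := by
      refine mul_ne_zero ?_ (ballVol_ne_zero d)
      have : 0 < κ * (φ c * c ^ d) := by positivity
      simpa using this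
    exact fun h => h1 (le_antisymm (h ▸ hκQ) bot_le)
  have hQtop : cylMeasure U Q ≠ ∞ := by
    refine ne_top_of_le_ne_top ?_ (cylMeasure_le_of_subset hφc.le hc
      (le_of_eq (by simp)) hQ)
    exact ENNReal.mul_ne_top ENNReal.ofReal_ne_top (ballVol_ne_top d)
  have hratio : cylMeasure U (Icc (t₀ - β * φ c) (t₀ + β * φ c) ×ˢ Metric.ball x₀ (α * c)) ≤
      A ^ 2 * cylMeasure U Q := by
    calc _ ≤ ENNReal.ofReal (2 * β * φ c * (α * c) ^ d) * ballVol d :=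
          cylMeasure_le_of_subset (by positivity) (by positivity)
            (le_of_eq (by rw [Real.volume_Icc]; congr 1; ring)) le_rfl
      _ = A ^ 2 * (ENNReal.ofReal (κ * (φ c * c ^ d)) * ballVol d) := by
          rw [hA2, ← mul_assoc, ← ENNReal.ofReal_mul (by positivity)]
          congr 2
          rw [mul_pow]
          field_simp
      _ ≤ _ := by gcongr
  have := lintegral_oscillation_volterraOp_le hU hK hT hN₅ hQm
    (measurableSet_Icc.prod Metric.isOpen_ball.measurableSet) hQ0 hQtop hratio
    (fun z hz w hw hne => hpair c t₀ x₀ hc z (hQΩ hz) w (hQΩ hw) (hQ hz) (hQ hw) hne)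
    hf' hf'' hf hM
  exact_mod_cast this

end Geometry

/-! ### The parabolic dyadic grid -/

/-- The length in time of the cells of generation `n`: the largest power of `2` not exceeding
`φ (2^(-n))`. Powers of `2` make the partitions nested. -/
noncomputable def timeStep (φ : ℝ → ℝ) (n : ℤ) : ℝ := 2 ^ Int.log 2 (φ (2 ^ (-n)))

/-- The parabolic dyadic grid: cells of generation `n` are products of a half-open interval
`((i - 1) τ, i τ]` in time, `τ = timeStep φ n`, and a half-open dyadic cube of side `2^(-n)` in
space. With intervals open on the left, `(0,∞)` and the open half-space are unions of cells. -/
noncomputable def gridCode (φ : ℝ → ℝ) {d : ℕ} (n : ℤ) (z : ℝ × Eucl d) : ℤ × (Fin d → ℤ) :=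
  (⌈z.1 / timeStep φ n⌉, fun i => ⌈z.2 i / 2 ^ (-n)⌉)

lemma ceil_div_natCast_congr {x y : ℝ} (h : ⌈x⌉ = ⌈y⌉) {m : ℕ} (hm : 0 < m) :
    ⌈x / m⌉ = ⌈y / m⌉ := by
  have hm' : (0 : ℝ) < m := by exact_mod_cast hm
  have key : ∀ (u : ℝ) (k : ℤ), u / m ≤ k ↔ ⌈u⌉ ≤ k * m := by
    intro u k
    rw [div_le_iff₀ hm', Int.ceil_le]
    push_cast
    rfl
  refine le_antisymm ?_ ?_ <;> rw [Int.ceil_le, key]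
  · rw [h, ← key]
    exact Int.le_ceil _
  · rw [← h, ← key]
    exact Int.le_ceil _

lemma ceil_div_eq_ceil_div_iff {x y h : ℝ} (hh : 0 < h) :
    ⌈y / h⌉ = ⌈x / h⌉ ↔ y ∈ Ioc ((⌈x / h⌉ - 1 : ℝ) * h) (⌈x / h⌉ * h) := by
  rw [Int.ceil_eq_iff, lt_div_iff₀ hh, div_le_iff₀ hh, mem_Ioc]

lemma abs_sub_lt_of_ceil_div_eq {x y h : ℝ} (hh : 0 < h) (hxy : ⌈y / h⌉ = ⌈x / h⌉) :
    |y - x| < h := by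
  have h1 := (ceil_div_eq_ceil_div_iff hh).1 hxy
  have h2 := (ceil_div_eq_ceil_div_iff (x := x) hh).1 rfl
  rw [abs_lt]
  constructor <;> nlinarith [h1.1, h1.2, h2.1, h2.2]

section Grid

variable {d : ℕ} {φ : ℝ → ℝ}

lemma timeStep_pos (φ : ℝ → ℝ) (n : ℤ) : 0 < timeStep φ n := by
  unfold timeStep
  positivity

lemma timeStep_le (hφ : IsScaling φ) (n : ℤ) : timeStep φ n ≤ φ (2 ^ (-n)) := by
  have := Int.zpow_log_le_self (b := 2) one_lt_two (hφ.pos (2 ^ (-n)) (by positivity))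
  exact_mod_cast this

lemma lt_two_mul_timeStep (φ : ℝ → ℝ) (n : ℤ) : φ (2 ^ (-n)) < 2 * timeStep φ n := by
  have := Int.lt_zpow_succ_log_self (b := 2) one_lt_two (φ (2 ^ (-n)))
  rw [zpow_add_one₀ (by norm_num)] at this
  unfold timeStep
  push_cast at this
  linarith

lemma two_zpow_neg_sub_one (n : ℤ) : (2 : ℝ) ^ (-(n - 1)) = 2 ^ (-n) * 2 := by
  rw [← zpow_add_one₀ two_ne_zero]
  congr 1
  ring

lemma exists_timeStep_sub_one (hφ : IsScaling φ) (n : ℤ) :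
    ∃ m : ℕ, 0 < m ∧ timeStep φ (n - 1) = timeStep φ n * m := by
  have h1 : (0 : ℝ) < 2 ^ (-n) := by positivity
  have hle : Int.log 2 (φ (2 ^ (-n))) ≤ Int.log 2 (φ (2 ^ (-(n - 1)))) := by
    refine Int.log_mono_right (hφ.pos _ h1) (hφ.mono h1 (show (0 : ℝ) < _ by positivity) ?_)
    rw [two_zpow_neg_sub_one]
    linarith
  obtain ⟨k, hk⟩ := Int.le.dest hle
  refine ⟨2 ^ k, by positivity, ?_⟩
  rw [timeStep, timeStep, ← hk, zpow_add₀ two_ne_zero]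
  simp

lemma mem_cell_gridCode {n : ℤ} {x y : ℝ × Eucl d} :
    y ∈ cell (gridCode φ) n x ↔ ⌈y.1 / timeStep φ n⌉ = ⌈x.1 / timeStep φ n⌉ ∧
      ∀ i, ⌈y.2 i / 2 ^ (-n)⌉ = ⌈x.2 i / 2 ^ (-n)⌉ := by
  change gridCode φ n y = gridCode φ n x ↔ _
  simp only [gridCode, Prod.mk.injEq, funext_iff]

lemma norm_le_of_forall_abs_le {v : Eucl d} {h : ℝ} (hh : 0 ≤ h) (hv : ∀ i, |v i| ≤ h) :
    ‖v‖ ≤ d * h := by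
  rw [EuclideanSpace.norm_eq]
  refine Real.sqrt_le_iff.2 ⟨by positivity, ?_⟩
  calc ∑ i, ‖v i‖ ^ 2 ≤ ∑ _i : Fin d, h ^ 2 := by
        gcongr with i
        exact hv i
    _ = d * h ^ 2 := by simp
    _ ≤ (d : ℝ) ^ 2 * h ^ 2 := by
        gcongr
        exact_mod_cast Nat.le_self_pow two_ne_zero d
    _ = _ := by ring

lemma norm_sub_le_of_mem_cell {n : ℤ} {x y : ℝ × Eucl d} (hy : y ∈ cell (gridCode φ) n x) :
    ‖y.2 - x.2‖ ≤ d * 2 ^ (-n) := by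
  refine norm_le_of_forall_abs_le (by positivity) fun i => ?_
  exact (abs_sub_lt_of_ceil_div_eq (by positivity) ((mem_cell_gridCode.1 hy).2 i)).le

lemma cell_subset_cylinder (n : ℤ) (x : ℝ × Eucl d) :
    cell (gridCode φ) n x ⊆ Ioc ((⌈x.1 / timeStep φ n⌉ - 1 : ℝ) * timeStep φ n)
      (⌈x.1 / timeStep φ n⌉ * timeStep φ n) ×ˢ Metric.ball x.2 ((d + 1) * 2 ^ (-n)) := by
  intro y hy
  refine ⟨(ceil_div_eq_ceil_div_iff (timeStep_pos φ n)).1 (mem_cell_gridCode.1 hy).1, ?_⟩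
  rw [Metric.mem_ball, dist_eq_norm]
  have h := norm_sub_le_of_mem_cell hy
  have : (0 : ℝ) < 2 ^ (-n) := by positivity
  linarith

lemma exists_subset_cell (n : ℤ) (x : ℝ × Eucl d) :
    ∃ v : Eucl d, Ioc ((⌈x.1 / timeStep φ n⌉ - 1 : ℝ) * timeStep φ n)
      (⌈x.1 / timeStep φ n⌉ * timeStep φ n) ×ˢ Metric.ball v (2 ^ (-n) / 2) ⊆
        cell (gridCode φ) n x := by
  refine ⟨WithLp.toLp 2 fun i => (⌈x.2 i / 2 ^ (-n)⌉ - 1 / 2 : ℝ) * 2 ^ (-n), ?_⟩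
  rintro y ⟨hy1, hy2⟩
  have hpos : (0 : ℝ) < 2 ^ (-n) := by positivity
  refine mem_cell_gridCode.2 ⟨(ceil_div_eq_ceil_div_iff (timeStep_pos φ n)).2 hy1, fun i => ?_⟩
  rw [ceil_div_eq_ceil_div_iff hpos]
  rw [Metric.mem_ball, dist_eq_norm] at hy2
  have h := abs_lt.1 ((PiLp.norm_apply_le _ i).trans_lt hy2)
  simp only [PiLp.sub_apply] at h
  constructor <;> nlinarith [h.1, h.2]

variable {U : Set (Eucl d)}

lemma volume_Ioc_sub_one_mul (k : ℤ) (τ : ℝ) :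
    volume (Ioc ((k - 1 : ℝ) * τ) (k * τ)) = ENNReal.ofReal τ := by
  rw [Real.volume_Ioc]
  congr 1
  ring

lemma cylMeasure_cell_le (n : ℤ) (x : ℝ × Eucl d) :
    cylMeasure U (cell (gridCode φ) n x) ≤
      ENNReal.ofReal (timeStep φ n * ((d + 1) * 2 ^ (-n)) ^ d) * ballVol d :=
  cylMeasure_le_of_subset (timeStep_pos φ n).le (by positivity)
    (volume_Ioc_sub_one_mul _ _).le (cell_subset_cylinder n x)

lemma le_cylMeasure_cell {n : ℤ} {x : ℝ × Eucl d}
    (hx : cell (gridCode φ) n x ⊆ Ioi (0 : ℝ) ×ˢ U) :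
    ENNReal.ofReal (timeStep φ n * (2 ^ (-n) / 2) ^ d) * ballVol d ≤
      cylMeasure U (cell (gridCode φ) n x) := by
  obtain ⟨v, hv⟩ := exists_subset_cell (φ := φ) n x
  exact le_cylMeasure_of_subset hx (timeStep_pos φ n).le (by positivity)
    (volume_Ioc_sub_one_mul _ _).ge hv

/-- `(0,∞) × ℝ^d` and `(0,∞) × ℝ^d_+` are unions of cells. -/
lemma mem_cyl_of_mem_cell (hd : 0 < d) (hU : U = univ ∨ U = halfSpace d hd) {n : ℤ}
    {x y : ℝ × Eucl d} (hy : y ∈ cell (gridCode φ) n x) (hx : x ∈ Ioi (0 : ℝ) ×ˢ U) :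
    y ∈ Ioi (0 : ℝ) ×ˢ U := by
  have key : ∀ a b h : ℝ, 0 < h → ⌈b / h⌉ = ⌈a / h⌉ → 0 < a → 0 < b := by
    intro a b h hh hab ha
    have h1 : 0 < ⌈b / h⌉ := by
      rw [hab, Int.ceil_pos]
      positivity
    rw [Int.ceil_pos] at h1
    exact (div_pos_iff_of_pos_right hh).1 h1
  obtain ⟨h1, h2⟩ := mem_cell_gridCode.1 hy
  refine ⟨key _ _ _ (timeStep_pos φ n) h1 hx.1, ?_⟩
  rcases hU with rfl | rfl
  · trivial
  · exact key _ _ _ (by positivity) (h2 ⟨0, hd⟩) hx.2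

lemma cell_subset_cyl (hd : 0 < d) (hU : U = univ ∨ U = halfSpace d hd) (n : ℤ)
    {x : ℝ × Eucl d} (hx : x ∈ Ioi (0 : ℝ) ×ˢ U) :
    cell (gridCode φ) n x ⊆ Ioi (0 : ℝ) ×ˢ U := fun _ hy => mem_cyl_of_mem_cell hd hU hy hx

lemma measurableSet_gridCode_fiber (n : ℤ) (i : ℤ × (Fin d → ℤ)) :
    MeasurableSet ((gridCode φ n : ℝ × Eucl d → _) ⁻¹' {i}) := by
  have h : Measurable (gridCode φ n : ℝ × Eucl d → ℤ × (Fin d → ℤ)) := by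
    unfold gridCode
    refine Measurable.prodMk (by fun_prop) (measurable_pi_iff.2 fun i => ?_)
    fun_prop
  exact h (measurableSet_singleton i)

lemma cylMeasure_cell_eq_zero (hd : 0 < d) (hU : U = univ ∨ U = halfSpace d hd) (n : ℤ)
    {x : ℝ × Eucl d} (hx : x ∉ Ioi (0 : ℝ) ×ˢ U) : cylMeasure U (cell (gridCode φ) n x) = 0 := by
  have hm : MeasurableSet (cell (gridCode φ) n x) := measurableSet_gridCode_fiber n _
  rw [cylMeasure, Measure.restrict_apply hm]
  have : cell (gridCode φ) n x ∩ Ioi (0 : ℝ) ×ˢ U = ∅ :=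
    eq_empty_of_forall_notMem fun y hy => hx (mem_cyl_of_mem_cell hd hU
      (cell_eq_of_mem hy.1 ▸ mem_cell_self _ _ x) hy.2)
  rw [this, measure_empty]

lemma tendsto_cylMeasure_cell (hφ : IsScaling φ) {x : ℝ × Eucl d}
    (hx : ∀ n, cell (gridCode φ) n x ⊆ Ioi (0 : ℝ) ×ˢ U) :
    Tendsto (fun n => cylMeasure U (cell (gridCode φ) n x)) atBot (𝓝 ∞) := by
  have h1 : Tendsto (fun n : ℤ => (2 : ℝ) ^ (-n)) atBot atTop :=
    by
    refine tendsto_atTop.2 fun b => ?_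
    obtain ⟨k, hk⟩ := pow_unbounded_of_one_lt b (one_lt_two (α := ℝ))
    filter_upwards [eventually_le_atBot (-(k : ℤ))] with n hn
    calc b ≤ (2 : ℝ) ^ (k : ℤ) := by exact_mod_cast hk.le
      _ ≤ 2 ^ (-n) := zpow_le_zpow_right₀ one_le_two (by omega)
  have h2 : Tendsto (fun n : ℤ => φ (2 ^ (-n)) / 2 * (1 / 2) ^ d) atBot atTop :=
    ((hφ.tendsto_top.comp h1).atTop_div_const two_pos).atTop_mul_const (by positivity)
  have h3 : Tendsto (fun n : ℤ => ENNReal.ofReal (φ (2 ^ (-n)) / 2 * (1 / 2) ^ d) * ballVol d)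
      atBot (𝓝 ∞) := by
    have := ENNReal.Tendsto.mul_const (b := ballVol d)
      (ENNReal.tendsto_ofReal_atTop.comp h2) (Or.inl (by simp))
    rwa [ENNReal.top_mul (ballVol_ne_zero d)] at this
  refine tendsto_of_tendsto_of_tendsto_of_le_of_le' h3 tendsto_const_nhds ?_
    (Eventually.of_forall fun _ => le_top)
  filter_upwards [eventually_le_atBot (0 : ℤ)] with n hn
  refine le_trans ?_ (le_cylMeasure_cell (hx n))
  have h4 : (1 : ℝ) ≤ 2 ^ (-n) := one_le_zpow₀ one_le_two (by omega)
  have := timeStep_pos φ n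
  gcongr
  linarith [lt_two_mul_timeStep φ n]

lemma exists_isGrid (hd : 0 < d) (hU : U = univ ∨ U = halfSpace d hd) (hφ : IsScaling φ) :
    ∃ D : ℝ≥0, IsGrid (cylMeasure U) (gridCode φ) D := by
  obtain ⟨C, hC0, hC⟩ := hφ.exists_dilation_bound 2 two_pos
  refine ⟨Real.toNNReal (2 * C * (4 * (d + 1)) ^ d), measurableSet_gridCode_fiber, ?_, ?_, ?_, ?_⟩
  · intro n x y hxy
    obtain ⟨h1, h2⟩ := mem_cell_gridCode.1 (show x ∈ cell (gridCode φ) n y from hxy)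
    refine mem_cell_gridCode.2 ⟨?_, fun i => ?_⟩
    · obtain ⟨m, hm, hm'⟩ := exists_timeStep_sub_one hφ n
      rw [hm', ← div_div, ← div_div]
      exact ceil_div_natCast_congr h1 hm
    · rw [two_zpow_neg_sub_one, ← div_div, ← div_div]
      exact ceil_div_natCast_congr (h2 i) two_pos
  · intro n x
    exact ne_top_of_le_ne_top (ENNReal.mul_ne_top ENNReal.ofReal_ne_top (ballVol_ne_top d))
      (cylMeasure_cell_le n x)
  · intro n x
    by_cases hx : x ∈ Ioi (0 : ℝ) ×ˢ U
    · refine (cylMeasure_cell_le (n - 1) x).trans ?_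
      refine le_trans ?_ (mul_le_mul' le_rfl (le_cylMeasure_cell (cell_subset_cyl hd hU n hx)))
      change _ ≤ ENNReal.ofReal _ * _
      rw [← mul_assoc, ← ENNReal.ofReal_mul (by positivity)]
      refine mul_le_mul' (ENNReal.ofReal_le_ofReal ?_) le_rfl
      have h1 : timeStep φ (n - 1) ≤ 2 * C * timeStep φ n := by
        have h2 := timeStep_le hφ (n - 1)
        rw [two_zpow_neg_sub_one, mul_comm] at h2
        have h3 := hC (2 ^ (-n)) (by positivity)
        have h4 := lt_two_mul_timeStep φ n
        nlinarith
      rw [two_zpow_neg_sub_one]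
      calc _ ≤ 2 * C * timeStep φ n * ((d + 1) * (2 ^ (-n) * 2)) ^ d := by gcongr
        _ = 2 * C * timeStep φ n * ((4 * (d + 1)) * (2 ^ (-n) / 2)) ^ d := by
            congr 2
            ring
        _ = _ := by
            rw [mul_pow]
            ring
    · rw [cylMeasure_cell_eq_zero hd hU _ hx]
      exact bot_le
  · intro x
    by_cases hx : x ∈ Ioi (0 : ℝ) ×ˢ U
    · exact Or.inr (tendsto_cylMeasure_cell hφ fun n => cell_subset_cyl hd hU n hx)
    · exact Or.inl fun n => cylMeasure_cell_eq_zero hd hU n hx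

lemma exists_cell_subset (hφ : IsScaling φ) (x : ℝ × Eucl d) {V : Set (ℝ × Eucl d)}
    (hV : V ∈ 𝓝 x) : ∃ n, cell (gridCode φ) n x ⊆ V := by
  obtain ⟨r, hr, hrV⟩ := Metric.mem_nhds_iff.1 hV
  have h1 : Tendsto (fun n : ℕ => (2 : ℝ) ^ (-(n : ℤ))) atTop (𝓝 0) := by
    have := tendsto_pow_atTop_nhds_zero_of_lt_one (r := (1 / 2 : ℝ)) (by norm_num) (by norm_num)
    refine this.congr fun n => ?_
    rw [zpow_neg, zpow_natCast, one_div, inv_pow]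
  have h2 : Tendsto (fun n : ℕ => (2 : ℝ) ^ (-(n : ℤ))) atTop (𝓝[>] 0) :=
    tendsto_nhdsWithin_iff.2 ⟨h1, Eventually.of_forall fun n => show (0 : ℝ) < _ by positivity⟩
  have h3 := (hφ.tendsto_zero.comp h2).eventually (gt_mem_nhds hr)
  have h4 : Tendsto (fun n : ℕ => (d : ℝ) * 2 ^ (-(n : ℤ))) atTop (𝓝 0) := by
    simpa using h1.const_mul (d : ℝ)
  obtain ⟨n, hn1, hn2⟩ := (h3.and (h4.eventually (gt_mem_nhds hr))).exists
  refine ⟨n, fun y hy => hrV ?_⟩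
  rw [Metric.mem_ball, Prod.dist_eq]
  refine max_lt ?_ ?_
  · rw [Real.dist_eq]
    exact ((abs_sub_lt_of_ceil_div_eq (timeStep_pos φ n) (mem_cell_gridCode.1 hy).1).trans_le
      (timeStep_le hφ n)).trans hn1
  · rw [dist_eq_norm]
    exact (norm_sub_le_of_mem_cell hy).trans_lt hn2

/-- A cell lies in a cylinder of comparable measure. -/
lemma exists_cylinder_of_cell (hφ : IsScaling φ) :
    ∃ κ : ℝ, 0 < κ ∧ ∀ n (x : ℝ × Eucl d), cell (gridCode φ) n x ⊆ Ioi (0 : ℝ) ×ˢ U →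
      ∃ (c t₀ : ℝ) (x₀ : Eucl d), 0 < c ∧
        cell (gridCode φ) n x ⊆ Ioc t₀ (t₀ + φ c) ×ˢ Metric.ball x₀ c ∧
        ENNReal.ofReal (κ * (φ c * c ^ d)) * ballVol d ≤
          cylMeasure U (cell (gridCode φ) n x) := by
  obtain ⟨C, hC0, hC⟩ := hφ.exists_dilation_bound (d + 1) (by positivity)
  refine ⟨(2 * C * (2 * (d + 1)) ^ d)⁻¹, by positivity, fun n x hx => ?_⟩
  have hpos : (0 : ℝ) < 2 ^ (-n) := by positivity
  have hτ := timeStep_pos φ n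
  have hφc := hφ.pos ((d + 1) * 2 ^ (-n)) (by positivity)
  refine ⟨(d + 1) * 2 ^ (-n), (⌈x.1 / timeStep φ n⌉ - 1 : ℝ) * timeStep φ n, x.2,
    by positivity, (cell_subset_cylinder n x).trans (prod_mono (Ioc_subset_Ioc_right ?_) le_rfl),
    le_trans ?_ (le_cylMeasure_cell hx)⟩
  · have h1 : φ (2 ^ (-n)) ≤ φ ((d + 1) * 2 ^ (-n)) :=
      hφ.mono hpos (show (0 : ℝ) < _ by positivity)
        (le_mul_of_one_le_left hpos.le (by linarith [d.cast_nonneg (α := ℝ)]))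
    linarith [timeStep_le hφ n]
  · refine mul_le_mul' (ENNReal.ofReal_le_ofReal ?_) le_rfl
    have h1 : φ ((d + 1) * 2 ^ (-n)) ≤ 2 * C * timeStep φ n := by
      have h3 := hC (2 ^ (-n)) hpos
      have h4 := lt_two_mul_timeStep φ n
      nlinarith
    calc _ ≤ (2 * C * (2 * (d + 1)) ^ d)⁻¹ *
          (2 * C * timeStep φ n * ((2 * (d + 1)) * (2 ^ (-n) / 2)) ^ d) := by
          refine mul_le_mul_of_nonneg_left (mul_le_mul h1 (le_of_eq ?_) (by positivity)
            (by positivity)) (by positivity)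
          congr 1
          ring
      _ = _ := by
          rw [mul_pow (2 * ((d : ℝ) + 1))]
          field_simp

/-- The part of a ball in `ℝ^d` or in the half-space `U`, centred in `U`, contains a ball of
half its radius. -/
lemma exists_ball_subset_inter (hd : 0 < d) (hU : U = univ ∨ U = halfSpace d hd) {x : Eucl d}
    (hx : x ∈ U) {c : ℝ} (hc : 0 < c) :
    ∃ y, Metric.ball y (c / 2) ⊆ Metric.ball x c ∩ U := by
  rcases hU with rfl | rfl
  · exact ⟨x, by simpa using Metric.ball_subset_ball (by linarith)⟩
  · refine ⟨x + EuclideanSpace.single ⟨0, hd⟩ (c / 2), fun w hw => ?_⟩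
    rw [Metric.mem_ball, dist_eq_norm] at hw
    have h1 := abs_lt.1 ((PiLp.norm_apply_le _ (⟨0, hd⟩ : Fin d)).trans_lt hw)
    simp only [PiLp.sub_apply, PiLp.add_apply, PiLp.single_apply, if_true] at h1
    refine ⟨?_, ?_⟩
    · rw [Metric.mem_ball, dist_eq_norm]
      have h2 : w - x = (w - (x + EuclideanSpace.single ⟨0, hd⟩ (c / 2))) +
          EuclideanSpace.single ⟨0, hd⟩ (c / 2) := by abel
      rw [h2]
      refine (norm_add_le _ _).trans_lt ?_
      rw [PiLp.norm_single, Real.norm_of_nonneg (by positivity)]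
      linarith
    · have hx' : 0 < x ⟨0, hd⟩ := hx
      change 0 < w ⟨0, hd⟩
      linarith [h1.1]

end Grid

/-! ### The bounds from `L_∞` to `BMO` and on `L_p` -/

section Main

variable {𝕜 : Type*} [RCLike 𝕜] {d : ℕ} {U : Set (Eucl d)} {K : ℝ → ℝ → Eucl d → Eucl d → 𝕜}
  {φ : ℝ → ℝ}

lemma measurableSet_of_eq (hd : 0 < d) (hU : U = univ ∨ U = halfSpace d hd) :
    MeasurableSet U := by
  rcases hU with rfl | rfl
  · exact MeasurableSet.univ
  · exact measurableSet_lt measurable_const (by fun_prop)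

lemma volterraOp_zero_ae (hT : IsL2Bounded U K) :
    volterraOp U K (0 : ℝ × Eucl d → 𝕜) =ᵐ[cylMeasure U] 0 := by
  obtain ⟨N₅, hN₅⟩ := hT.bound
  have h := hN₅ 0 MemLp.zero'
  rw [eLpNorm_zero, mul_zero] at h
  exact (eLpNorm_eq_zero_iff (hT.tendsto 0 MemLp.zero').1.1 two_ne_zero).1
    (le_antisymm h bot_le)

/-- `T` maps `L_∞` into `BMO`. -/
theorem exists_sharpFn_le (hd : 0 < d) (hU : U = univ ∨ U = halfSpace d hd) (hφ : IsScaling φ)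
    (hK : IsVolterraKernel U K) (hT : IsL2Bounded U K) (hH : HormanderCondition U φ K) :
    ∃ C : ℝ≥0, ∀ f : ℝ × Eucl d → 𝕜, MemLp f 2 (cylMeasure U) → MemLp f ∞ (cylMeasure U) →
      ∀ z, sharpFn U φ (volterraOp U K f) z ≤ C * eLpNorm f ∞ (cylMeasure U) := by
  have hUm := measurableSet_of_eq hd hU
  obtain ⟨C, hC⟩ := exists_oscillation_bound (κ := (1 / 2) ^ d) hUm hφ hK hT hH (by positivity)
  refine ⟨C, fun f hf hfb z => ?_⟩
  set M : ℝ≥0 := (eLpNorm f ∞ (cylMeasure U)).toNNReal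
  have hM : (M : ℝ≥0∞) = eLpNorm f ∞ (cylMeasure U) :=
    ENNReal.coe_toNNReal hfb.eLpNorm_ne_top
  have hfM : ∀ᵐ z ∂(cylMeasure U), ‖f z‖ₑ ≤ M := by
    rw [hM, eLpNorm_exponent_top]
    exact enorm_ae_le_eLpNormEssSup f _
  refine iSup_le fun c => iSup_le fun t₀ => iSup_le fun x₀ => iSup_le fun ⟨hc, ht₀, hx₀, _⟩ => ?_
  set Q := cylinder U φ c t₀ x₀ with hQ
  have hφc := hφ.pos c hc
  have hQm : MeasurableSet Q :=
    measurableSet_Ioc.prod (Metric.isOpen_ball.measurableSet.inter hUm)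
  have hQΩ : Q ⊆ Ioi (0 : ℝ) ×ˢ U :=
    prod_mono (fun s hs => lt_of_le_of_lt ht₀ hs.1) inter_subset_right
  obtain ⟨y, hy⟩ := exists_ball_subset_inter hd hU hx₀ hc
  have hlow : ENNReal.ofReal ((1 / 2) ^ d * (φ c * c ^ d)) * ballVol d ≤ cylMeasure U Q := by
    have h := le_cylMeasure_of_subset (U := U) hQΩ (I := Ioc t₀ (t₀ + φ c)) (x := y)
      (r := c / 2) hφc.le (by positivity) (by simp) (prod_mono le_rfl hy)
    refine le_trans (le_of_eq ?_) h
    congr 2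
    rw [div_pow, div_pow, one_pow]
    ring
  have h := hC f 0 f M MemLp.zero' hf (Eventually.of_forall fun z => by simp) hfM Q c t₀ x₀ hQm hc
    hQΩ (prod_mono le_rfl inter_subset_left) hlow
  have h0 : ∫⁻ z in Q, ‖volterraOp U K (0 : ℝ × Eucl d → 𝕜) z‖ₑ ∂(cylMeasure U) = 0 := by
    rw [lintegral_congr_ae (g := fun _ => 0), lintegral_zero]
    filter_upwards [ae_restrict_of_ae (volterraOp_zero_ae hT)] with z hz
    simp [hz]
  rw [h0, mul_zero, add_zero, hM, cylMeasure_restrict hQΩ] at h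
  have hvol : cylMeasure U Q = volume Q := Measure.restrict_eq_self _ hQΩ
  rw [hvol] at h hlow
  rw [setLAverage_eq]
  exact ENNReal.div_le_of_le_mul h

/-- The `L_p` bound for `T`, `p > 2`, from the interpolation on the parabolic dyadic grid. -/
lemma exists_lintegral_rpow_volterraOp_le (hd : 0 < d) (hU : U = univ ∨ U = halfSpace d hd)
    (hφ : IsScaling φ) (hK : IsVolterraKernel U K) (hT : IsL2Bounded U K)
    (hH : HormanderCondition U φ K) {p : ℝ} (hp : 2 < p) :
    ∃ A : ℝ≥0, ∀ f : ℝ × Eucl d → 𝕜, MemLp f 2 (cylMeasure U) →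
      ∫⁻ z, ‖volterraOp U K f z‖ₑ ^ p ∂(cylMeasure U) ≤
        A * ∫⁻ z, ‖f z‖ₑ ^ p ∂(cylMeasure U) := by
  have hUm := measurableSet_of_eq hd hU
  set μ := cylMeasure U with hμ
  have : IsLocallyFiniteMeasure μ := by rw [hμ, cylMeasure]; infer_instance
  obtain ⟨D, hG⟩ := exists_isGrid hd hU hφ
  obtain ⟨κ, hκ, hcyl⟩ := exists_cylinder_of_cell (U := U) hφ
  obtain ⟨C, hC⟩ := exists_oscillation_bound hUm hφ hK hT hH hκ
  obtain ⟨N₅, hN₅⟩ := hT.bound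
  obtain ⟨A, hA⟩ := hG.lintegral_rpow_le (𝕜 := 𝕜) (fun x V hV => exists_cell_subset hφ x hV) hp
    C (N₅ ^ 2)
  refine ⟨A, fun f hf => ?_⟩
  set fm : ℝ × Eucl d → 𝕜 := hf.1.mk f with hfm_def
  have hfm : f =ᵐ[μ] fm := hf.1.ae_eq_mk
  have hfm_meas : Measurable fm := hf.1.stronglyMeasurable_mk.measurable
  have hfmL : MemLp fm 2 μ := hf.ae_eq hfm
  have hfp : ∫⁻ z, ‖f z‖ₑ ^ p ∂μ = ∫⁻ z, ‖fm z‖ₑ ^ p ∂μ := by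
    refine lintegral_congr_ae ?_
    filter_upwards [hfm] with z hz
    rw [hz]
  rw [hfp]
  refine hA fm _ hfm_meas hfmL (hT.tendsto f hf).1 fun h hh => ?_
  have hS : MeasurableSet {z | h < ‖fm z‖} := measurableSet_lt measurable_const hfm_meas.norm
  -- `f` is split at height `h`; the lower part is bounded, the upper part enters through `L_2`
  set S := {z | h < ‖fm z‖} with hS_def
  have hf' : MemLp (S.indicator fm) 2 μ := hfmL.indicator hS
  have hf'' : MemLp (Sᶜ.indicator fm) 2 μ := hfmL.indicator hS.compl
  have hM : ∀ᵐ z ∂μ, ‖Sᶜ.indicator fm z‖ₑ ≤ (Real.toNNReal h : ℝ≥0∞) := by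
    refine Eventually.of_forall fun z => ?_
    by_cases hz : z ∈ S
    · simp [hz]
    · rw [indicator_of_mem (by exact hz), ← ofReal_norm]
      exact ENNReal.ofReal_le_ofReal (not_lt.1 hz)
  have hg' := (hT.tendsto _ hf').1
  refine ⟨fun z => ‖volterraOp U K (S.indicator fm) z‖ₑ, hg'.1.enorm, ?_, fun n x => ?_⟩
  · rw [← sq_eLpNorm_two, ← lintegral_indicator hS]
    calc _ ≤ (N₅ * eLpNorm (S.indicator fm) 2 μ) ^ 2 := by
          gcongr
          exact hN₅ _ hf'
      _ = _ := by
          rw [mul_pow, sq_eLpNorm_two, ENNReal.coe_pow]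
          congr 2
          ext z
          by_cases hz : z ∈ S <;> simp [hz]
  · by_cases hx : x ∈ Ioi (0 : ℝ) ×ˢ U
    · have hsub := cell_subset_cyl (φ := φ) hd hU n hx
      obtain ⟨c, t₀, x₀, hc, hcell, hκcell⟩ := hcyl n x hsub
      exact hC f _ _ _ hf' hf'' (hfm.trans (EventuallyEq.of_eq
        (indicator_self_add_compl S fm).symm)) hM _ c t₀ x₀ (hG.measurableSet_cell n x) hc hsub
        hcell hκcell
    · rw [Measure.restrict_eq_zero.2 (cylMeasure_cell_eq_zero hd hU n hx)]
      simp

end Main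

end VolterraBMO

theorem mainTheorem3 {𝕜 : Type*} [RCLike 𝕜] (d : ℕ) (hd : 0 < d)
    (U : Set (VolterraBMO.Eucl d)) (hU : U = univ ∨ U = VolterraBMO.halfSpace d hd)
    (φ : ℝ → ℝ) (hφ : VolterraBMO.IsScaling φ)
    (K : ℝ → ℝ → VolterraBMO.Eucl d → VolterraBMO.Eucl d → 𝕜)
    (hK : VolterraBMO.IsVolterraKernel U K)
    (hT : VolterraBMO.IsL2Bounded U K)
    (hH : VolterraBMO.HormanderCondition U φ K)
    (p : ℝ) (hp : 2 < p) :
    ∃ N : ℝ≥0, ∀ f : ℝ × VolterraBMO.Eucl d → 𝕜,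
      MemLp f 2 (VolterraBMO.cylMeasure U) → MemLp f ∞ (VolterraBMO.cylMeasure U) →
        eLpNorm (VolterraBMO.sharpFn U φ (VolterraBMO.volterraOp U K f)) ∞
            (VolterraBMO.cylMeasure U) ≤ N * eLpNorm f ∞ (VolterraBMO.cylMeasure U) ∧
        eLpNorm (VolterraBMO.volterraOp U K f) (ENNReal.ofReal p)
            (VolterraBMO.cylMeasure U) ≤
          N * eLpNorm f (ENNReal.ofReal p) (VolterraBMO.cylMeasure U) := by
  obtain ⟨C, hC⟩ := VolterraBMO.exists_sharpFn_le hd hU hφ hK hT hH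
  obtain ⟨A, hA⟩ := VolterraBMO.exists_lintegral_rpow_volterraOp_le hd hU hφ hK hT hH hp
  have hp0 : 0 < p := by linarith
  refine ⟨max C (A ^ (1 / p)), fun f hf hfb => ⟨?_, ?_⟩⟩
  · rw [eLpNorm_exponent_top]
    refine eLpNormEssSup_le_of_ae_enorm_bound (Eventually.of_forall fun z => ?_)
    rw [enorm_eq_self]
    refine (hC f hf hfb z).trans ?_
    gcongr
    exact le_max_left _ _
  · have hp1 : ENNReal.ofReal p ≠ 0 := by simpa using hp0
    rw [eLpNorm_eq_lintegral_rpow_enorm_toReal hp1 ENNReal.ofReal_ne_top,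
      eLpNorm_eq_lintegral_rpow_enorm_toReal hp1 ENNReal.ofReal_ne_top,
      ENNReal.toReal_ofReal hp0.le]
    calc _ ≤ (A * ∫⁻ z, ‖f z‖ₑ ^ p ∂(VolterraBMO.cylMeasure U)) ^ (1 / p) := by
          gcongr
          exact hA f hf
      _ = (A ^ (1 / p) : ℝ≥0) * (∫⁻ z, ‖f z‖ₑ ^ p ∂(VolterraBMO.cylMeasure U)) ^ (1 / p) := by
          rw [ENNReal.mul_rpow_of_nonneg _ _ (by positivity),
            ENNReal.coe_rpow_of_nonneg _ (by positivity)]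
      _ ≤ _ := by
          gcongr
          exact le_max_right _ _
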